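/- Theorem (computation of local cohomology). Let $(R,\mathfrak m)$ be a Cohen--Macaulay local ring of dimension $2$, let $I,J$ be $\mathfrak m$-primary ideals of $R$, and let $(a,b)$ be a joint reduction of $(I,J)$, that is, $a\in I$, $b\in J$ and $I^{r+1}J^{s+1}=aI^rJ^{s+1}+bI^{r+1}J^s$ for all $r,s\gg 0$. Let $$\mathcal R'=\bigoplus_{r,s\in\mathbb Z} I^rJ^s\,t_1^rt_2^s\subseteq R[t_1,t_1^{-1},t_2,t_2^{-1}]$$ be the bigraded extended Rees algebra (with $I^n=J^n=R$ for $n\le 0$), and let $[H^2_{(at_1,bt_2)}(\mathcal R')]_{(r,s)}$ be the component of bidegree $(r,s)$ of the second local cohomology module of $\mathcal R'$ with support in the ideal $(at_1,bt_2)$. For $r,s,k\ge 0$ put $$L_{(a,b)}(r,s;k)=\frac{I^{r+k}J^{s+k}}{a^kI^rJ^{s+k}+b^kI^{r+k}J^s},$$ and let $\mu_k\colon L_{(a,b)}(r,s;k)\to L_{(a,b)}(r,s;k+1)$ be the $R$-linear map induced by multiplication by $ab$. Then for all $r,s\ge 0$: (1) there is an isomorphism of $R$-modules $$[H^2_{(at_1,bt_2)}(\mathcal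 R')]_{(r,s)}\;\cong\;\varinjlim_k L_{(a,b)}(r,s;k),$$ where the direct limit is taken along the maps $\mu_k$; (2) if in addition $(a,b)$ satisfies the superficial conditions, that is, $$(a)\cap I^rJ^s=aI^{r-1}J^s\ \text{ for } r\gg 0 \text{ and all } s\ge 0,\qquad (b)\cap I^rJ^s=bI^rJ^{s-1}\ \text{ for } s\gg 0 \text{ and all } r\ge 0,$$ then $\mu_k$ is injective for all $k\gg 0$. -/

import Mathlib

universe u

open CategoryTheory

noncomputable section

/-! ### Cohen-Macaulay local rings -/

/-- A Cohen-Macaulay local ring: a Noetherian local ring possessing a regular sequence (necessarily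
inside the maximal ideal) whose length is the Krull dimension. -/
structure IsCohenMacaulayLocalRing (R : Type*) [CommRing R] : Prop where
  isLocalRing : IsLocalRing R
  isNoetherianRing : IsNoetherianRing R
  exists_isRegular : ∃ rs : List R,
    RingTheory.Sequence.IsRegular R rs ∧ ringKrullDim R = (rs.length : WithBot ℕ∞)

/-! ### Joint reductions and superficial conditions -/

section JointReduction

variable {R : Type*} [CommRing R]

/-- `(a, b)` is a joint reduction of `(I, J)`: `a ∈ I`, `b ∈ J` and
`I^(r+1) J^(s+1) = a I^r J^(s+1) + b I^(r+1) J^s` for all large `r, s`. -/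
structure IsJointReduction (I J : Ideal R) (a b : R) : Prop where
  left_mem : a ∈ I
  right_mem : b ∈ J
  eventually_eq : ∃ n : ℕ, ∀ r s : ℕ, n ≤ r → n ≤ s →
    I ^ (r + 1) * J ^ (s + 1) =
      Ideal.span {a} * (I ^ r * J ^ (s + 1)) ⊔ Ideal.span {b} * (I ^ (r + 1) * J ^ s)

/-- The superficial conditions on `(a, b)`: `(a) ∩ I^r J^s = a I^(r-1) J^s` for `r ≫ 0` and all
`s ≥ 0`, and `(b) ∩ I^r J^s = b I^r J^(s-1)` for `s ≫ 0` and all `r ≥ 0` (the exponents that go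
down by one are written as successors). -/
structure SuperficialConditions (I J : Ideal R) (a b : R) : Prop where
  left : ∃ n : ℕ, ∀ r s : ℕ, n ≤ r →
    Ideal.span {a} ⊓ I ^ (r + 1) * J ^ s = Ideal.span {a} * (I ^ r * J ^ s)
  right : ∃ n : ℕ, ∀ r s : ℕ, n ≤ s →
    Ideal.span {b} ⊓ I ^ r * J ^ (s + 1) = Ideal.span {b} * (I ^ r * J ^ s)

end JointReduction

/-! ### The modules `L_{(a,b)}(r,s;k)` and their direct system -/

namespace LModule

variable {R : Type*} [CommRing R]

/-- `I^(r+k) J^(s+k)`. -/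
def num (I J : Ideal R) (r s k : ℕ) : Ideal R := I ^ (r + k) * J ^ (s + k)

/-- `a^k I^r J^(s+k) + b^k I^(r+k) J^s`. -/
def den (I J : Ideal R) (a b : R) (r s k : ℕ) : Ideal R :=
  Ideal.span {a ^ k} * (I ^ r * J ^ (s + k)) ⊔ Ideal.span {b ^ k} * (I ^ (r + k) * J ^ s)

theorem den_le_num {I J : Ideal R} {a b : R} (ha : a ∈ I) (hb : b ∈ J) (r s k : ℕ) :
    den I J a b r s k ≤ num I J r s k := by
  have h1 : Ideal.span {a ^ k} ≤ I ^ k :=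
    (Ideal.span_singleton_le_iff_mem _).2 (Ideal.pow_mem_pow ha k)
  have h2 : Ideal.span {b ^ k} ≤ J ^ k :=
    (Ideal.span_singleton_le_iff_mem _).2 (Ideal.pow_mem_pow hb k)
  refine sup_le ?_ ?_
  · calc _ ≤ I ^ k * (I ^ r * J ^ (s + k)) := Ideal.mul_mono_left h1
      _ = num I J r s k := by rw [num]; ring
  · calc _ ≤ J ^ k * (I ^ (r + k) * J ^ s) := Ideal.mul_mono_left h2
      _ = num I J r s k := by rw [num]; ring

theorem pow_mul_mem_num {I J : Ideal R} {a b : R} (ha : a ∈ I) (hb : b ∈ J) (r s k n : ℕ)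
    {x : R} (hx : x ∈ num I J r s k) : (a * b) ^ n * x ∈ num I J r s (k + n) := by
  have h : (a * b) ^ n ∈ I ^ n * J ^ n := by
    rw [mul_pow]
    exact Ideal.mul_mem_mul (Ideal.pow_mem_pow ha n) (Ideal.pow_mem_pow hb n)
  have h' := Ideal.mul_mem_mul h hx
  have e : I ^ n * J ^ n * num I J r s k = num I J r s (k + n) := by simp only [num]; ring
  rwa [e] at h'

theorem pow_mul_mem_den {I J : Ideal R} {a b : R} (ha : a ∈ I) (hb : b ∈ J) (r s k n : ℕ)
    {x : R} (hx : x ∈ den I J a b r s k) : (a * b) ^ n * x ∈ den I J a b r s (k + n) := by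
  have h1 : Ideal.span {a ^ n} ≤ I ^ n :=
    (Ideal.span_singleton_le_iff_mem _).2 (Ideal.pow_mem_pow ha n)
  have h2 : Ideal.span {b ^ n} ≤ J ^ n :=
    (Ideal.span_singleton_le_iff_mem _).2 (Ideal.pow_mem_pow hb n)
  have h : (a * b) ^ n * x ∈ Ideal.span {a ^ n} * Ideal.span {b ^ n} * den I J a b r s k := by
    rw [mul_pow]
    exact Ideal.mul_mem_mul (Ideal.mul_mem_mul (Ideal.mem_span_singleton_self _)
      (Ideal.mem_span_singleton_self _)) hx
  have hs : ∀ (c : R), Ideal.span {c ^ (k + n)} = Ideal.span {c ^ n} * Ideal.span {c ^ k} := by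
    intro c
    rw [Ideal.span_singleton_mul_span_singleton, ← pow_add, add_comm]
  refine (show _ ≤ den I J a b r s (k + n) from ?_) h
  rw [den, Ideal.mul_sup, den, hs, hs]
  refine sup_le_sup ?_ ?_
  · calc _ = Ideal.span {a ^ n} * Ideal.span {a ^ k} *
              (I ^ r * (Ideal.span {b ^ n} * J ^ (s + k))) := by ring
      _ ≤ Ideal.span {a ^ n} * Ideal.span {a ^ k} * (I ^ r * (J ^ n * J ^ (s + k))) :=
          Ideal.mul_mono_right (Ideal.mul_mono_right (Ideal.mul_mono_left h2))
      _ = _ := by ring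
  · calc _ = Ideal.span {b ^ n} * Ideal.span {b ^ k} *
              (Ideal.span {a ^ n} * I ^ (r + k) * J ^ s) := by ring
      _ ≤ Ideal.span {b ^ n} * Ideal.span {b ^ k} * (I ^ n * I ^ (r + k) * J ^ s) :=
          Ideal.mul_mono_right (Ideal.mul_mono_left (Ideal.mul_mono_left h1))
      _ = _ := by ring

end LModule

section LModuleSystem

variable {R : Type*} [CommRing R]

/-- `L_{(a,b)}(r,s;k) = I^(r+k) J^(s+k) / (a^k I^r J^(s+k) + b^k I^(r+k) J^s)`. -/
abbrev LModule (I J : Ideal R) (a b : R) (r s k : ℕ) : Type _ :=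
  (LModule.num I J r s k) ⧸
    (LModule.den I J a b r s k).submoduleOf (LModule.num I J r s k)

namespace LModule

variable {I J : Ideal R} {a b : R}

/-- The map `L_{(a,b)}(r,s;k) → L_{(a,b)}(r,s;l)` induced by multiplication by `c`. -/
def mulMap (r s k l : ℕ) (c : R) (hnum : ∀ x ∈ num I J r s k, c * x ∈ num I J r s l)
    (hden : ∀ x ∈ den I J a b r s k, c * x ∈ den I J a b r s l) :
    LModule I J a b r s k →ₗ[R] LModule I J a b r s l :=
  Submodule.mapQ _ _ ((LinearMap.lsmul R R c).restrict hnum) (fun x hx => hden x.1 hx)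

/-- The map `μ_k : L_{(a,b)}(r,s;k) → L_{(a,b)}(r,s;k+1)`, multiplication by `ab`. -/
def mu (ha : a ∈ I) (hb : b ∈ J) (r s k : ℕ) :
    LModule I J a b r s k →ₗ[R] LModule I J a b r s (k + 1) :=
  mulMap r s k (k + 1) (a * b)
    (fun x hx => by simpa using pow_mul_mem_num ha hb r s k 1 hx)
    (fun x hx => by simpa using pow_mul_mem_den ha hb r s k 1 hx)

/-- The transition map `L_{(a,b)}(r,s;i) → L_{(a,b)}(r,s;j)` for `i ≤ j`, multiplication by
`(ab)^(j-i)`. -/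
def transition (ha : a ∈ I) (hb : b ∈ J) (r s i j : ℕ) (hij : i ≤ j) :
    LModule I J a b r s i →ₗ[R] LModule I J a b r s j :=
  mulMap r s i j ((a * b) ^ (j - i))
    (fun x hx => by
      simpa [Nat.add_sub_cancel' hij] using pow_mul_mem_num ha hb r s i (j - i) hx)
    (fun x hx => by
      simpa [Nat.add_sub_cancel' hij] using pow_mul_mem_den ha hb r s i (j - i) hx)

theorem transition_mk (ha : a ∈ I) (hb : b ∈ J) (r s i j : ℕ) (hij : i ≤ j)
    (x : num I J r s i) (hx : (a * b) ^ (j - i) * (x : R) ∈ num I J r s j) :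
    transition ha hb r s i j hij (Submodule.Quotient.mk x) =
      Submodule.Quotient.mk ⟨(a * b) ^ (j - i) * (x : R), hx⟩ := rfl

theorem mu_mk (ha : a ∈ I) (hb : b ∈ J) (r s k : ℕ)
    (x : num I J r s k) (hx : a * b * (x : R) ∈ num I J r s (k + 1)) :
    mu ha hb r s k (Submodule.Quotient.mk x) =
      Submodule.Quotient.mk ⟨a * b * (x : R), hx⟩ := rfl

/-- The one-step transition maps are the maps `μ_k`. -/
theorem transition_succ (ha : a ∈ I) (hb : b ∈ J) (r s k : ℕ) :
    transition ha hb r s k (k + 1) (Nat.le_succ k) = mu ha hb r s k := by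
  simp only [transition, mu, Nat.add_sub_cancel_left, pow_one]

/-- The direct limit `lim_k L_{(a,b)}(r,s;k)` under multiplication by `ab`. -/
abbrev Limit (ha : a ∈ I) (hb : b ∈ J) (r s : ℕ) : Type _ :=
  Module.DirectLimit (fun k : ℕ => LModule I J a b r s k)
    (fun i j hij => transition ha hb r s i j hij)

end LModule

end LModuleSystem

/-! ### Graded modules, graded resolutions and the grading on local cohomology -/

section GradedLocalCohomology

variable {G : Type*} [AddCommGroup G] [DecidableEq G] {A : Type u} [CommRing A]

/-- The subgroups `ℳ g` make the `A`-module `M` a `G`-graded module over `A` graded by `𝒜`: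
`M = ⨁ g, ℳ g` and `𝒜 g • ℳ h ⊆ ℳ (g + h)`. -/
structure IsGradedModule (𝒜 : G → AddSubgroup A) {M : Type*} [AddCommGroup M] [Module A M]
    (ℳ : G → AddSubgroup M) : Prop where
  isInternal : DirectSum.IsInternal ℳ
  smul_mem : ∀ (g h : G) (c : A) (m : M), c ∈ 𝒜 g → m ∈ ℳ h → c • m ∈ ℳ (g + h)

/-- The function `f` between modules graded by `ℳ` and `𝒩` is homogeneous of degree `d`. -/
def IsHomogeneousOfDegree {M N : Type*} [AddCommGroup M] [AddCommGroup N]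
    (ℳ : G → AddSubgroup M) (𝒩 : G → AddSubgroup N) (d : G) (f : M → N) : Prop :=
  ∀ (h : G) (m : M), m ∈ ℳ h → f m ∈ 𝒩 (h + d)

/-- The grading induced on `A ⧸ K` by a grading of `A` (of interest for homogeneous `K`). -/
def quotientGrading (𝒜 : G → AddSubgroup A) (K : Ideal A) (g : G) : AddSubgroup (A ⧸ K) :=
  (𝒜 g).map (Ideal.Quotient.mk K).toAddMonoidHom

/-- A graded projective resolution of the graded module `(N, 𝒩)`: a projective resolution whose
terms are graded modules and whose differentials and augmentation are homogeneous of degree `0`. -/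
structure GradedProjectiveResolution (𝒜 : G → AddSubgroup A) (N : ModuleCat.{u} A)
    (𝒩 : G → AddSubgroup N) where
  /-- the underlying projective resolution -/
  res : ProjectiveResolution N
  /-- the grading of the terms -/
  grading : ∀ n : ℕ, G → AddSubgroup (res.complex.X n)
  isGraded : ∀ n : ℕ, IsGradedModule 𝒜 (grading n)
  d_homogeneous : ∀ n : ℕ,
    IsHomogeneousOfDegree (grading (n + 1)) (grading n) 0 (res.complex.d (n + 1) n).hom
  π_homogeneous : IsHomogeneousOfDegree (grading 0) 𝒩 0 (fun x => ((res.π.f 0).hom x : N))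

/-- `ξ ∈ Ext^i(N, M)` is the class of a homogeneous cocycle of degree `d`: for some graded
projective resolution `P` of `N`, under the identification of `Ext^i(N, M)` with the cohomology of
`Hom(P, M)`, it is the class of a cocycle `P_i → M` that is homogeneous of degree `d`. -/
def IsHomogeneousExtClass (𝒜 : G → AddSubgroup A) {N M : ModuleCat.{u} A}
    (𝒩 : G → AddSubgroup N) (ℳ : G → AddSubgroup M) (i : ℕ) (d : G)
    (ξ : ((Ext A (ModuleCat.{u} A) i).obj (Opposite.op N)).obj M) : Prop :=
  ∃ (P : GradedProjectiveResolution 𝒜 N 𝒩)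
    (z : (P.res.complex.linearYonedaObj A M).cycles i) (f : P.res.complex.X i ⟶ M),
    ((P.res.complex.linearYonedaObj A M).iCycles i).hom z = f ∧
    IsHomogeneousOfDegree (P.grading i) ℳ d f.hom ∧
    (P.res.isoExt i M).hom.hom ξ = ((P.res.complex.linearYonedaObj A M).homologyπ i).hom z

/-- The canonical map `Ext^i(A/K^t, M) → H^i_K(M)` into `H^i_K(M) = lim_t Ext^i(A/K^t, M)`. -/
def extToLocalCohomology (K : Ideal A) (i t : ℕ) (M : ModuleCat.{u} A) :
    ((Ext A (ModuleCat.{u} A) i).obj (Opposite.op (ModuleCat.of A (A ⧸ K ^ t)))).obj M ⟶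
      (localCohomology K i).obj M :=
  (Limits.colimit.ι
    (localCohomology.diagram (localCohomology.idealPowersDiagram K) i)
    (Opposite.op (Opposite.op t))).app M

/-- The degree `d` component `[H^i_K(M)]_d` of the local cohomology of the graded module `(M, ℳ)`
with support in the homogeneous ideal `K` of the graded `R`-algebra `A`, as an `R`-module. It is
spanned by the images of the homogeneous classes of degree `d` in `Ext^i(A/K^t, M)`, for all `t`.
(Here the image of `R` in `A` is meant to be of degree `0`.) -/
def localCohomologyComponent (R : Type u) [CommRing R] [Algebra R A] (𝒜 : G → AddSubgroup A)
    (K : Ideal A) (i : ℕ) (M : ModuleCat.{u} A) (ℳ : G → AddSubgroup M) (d : G) :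
    Submodule R ((ModuleCat.restrictScalars (algebraMap R A)).obj ((localCohomology K i).obj M)) :=
  Submodule.span R
    {x | ∃ (t : ℕ) (ξ : ((Ext A (ModuleCat.{u} A) i).obj
        (Opposite.op (ModuleCat.of A (A ⧸ K ^ t)))).obj M),
      IsHomogeneousExtClass 𝒜 (quotientGrading 𝒜 (K ^ t)) ℳ i d ξ ∧
      (extToLocalCohomology K i t M).hom ξ = x}

end GradedLocalCohomology

/-! ### The bigraded extended Rees algebra -/

section ExtendedRees

variable {R : Type u} [CommRing R]

/-- `I^r J^s` for integers `r, s`, where non-positive powers of an ideal are the unit ideal. -/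
def bigradedPower (I J : Ideal R) (g : ℤ × ℤ) : Ideal R := I ^ g.1.toNat * J ^ g.2.toNat

theorem bigradedPower_mul_le (I J : Ideal R) (g h : ℤ × ℤ) :
    bigradedPower I J g * bigradedPower I J h ≤ bigradedPower I J (g + h) := by
  calc bigradedPower I J g * bigradedPower I J h
      = I ^ (g.1.toNat + h.1.toNat) * J ^ (g.2.toNat + h.2.toNat) := by
        simp only [bigradedPower]; ring
    _ ≤ bigradedPower I J (g + h) := by
        refine Ideal.mul_mono (Ideal.pow_le_pow_right ?_) (Ideal.pow_le_pow_right ?_)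
        · rw [Prod.fst_add]; omega
        · rw [Prod.snd_add]; omega

/-- The bigraded extended Rees algebra `R' = ⨁_{r,s ∈ ℤ} I^r J^s t₁^r t₂^s`, a subalgebra of the
Laurent polynomial ring `R[t₁, t₁⁻¹, t₂, t₂⁻¹]`, realised as the group algebra of `ℤ × ℤ`. -/
def extendedRees (I J : Ideal R) : Subalgebra R (AddMonoidAlgebra R (ℤ × ℤ)) where
  carrier := {f | ∀ g : ℤ × ℤ, f.coeff g ∈ bigradedPower I J g}
  mul_mem' := by
    intro f g hf hg p
    rw [AddMonoidAlgebra.coeff_mul, Finsupp.sum]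
    refine Ideal.sum_mem _ fun m₁ _ => ?_
    rw [Finsupp.sum]
    refine Ideal.sum_mem _ fun m₂ _ => ?_
    split_ifs with h
    · rw [← h]
      exact bigradedPower_mul_le I J m₁ m₂ (Ideal.mul_mem_mul (hf m₁) (hg m₂))
    · exact Ideal.zero_mem _
  add_mem' := by
    intro f g hf hg p
    rw [AddMonoidAlgebra.coeff_add, Finsupp.add_apply]
    exact Ideal.add_mem _ (hf p) (hg p)
  algebraMap_mem' := by
    intro c p
    rw [AddMonoidAlgebra.coe_algebraMap, Function.comp_apply, AddMonoidAlgebra.coeff_single,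
      Finsupp.single_apply]
    split_ifs with h
    · rw [← h]
      simp [bigradedPower]
    · exact Ideal.zero_mem _

/-- The component `I^r J^s t₁^r t₂^s` of the extended Rees algebra, for `g = (r, s)`. -/
def extendedReesGrading (I J : Ideal R) (g : ℤ × ℤ) : AddSubgroup (extendedRees I J) where
  carrier := {f | ∀ h : ℤ × ℤ, h ≠ g → (f : AddMonoidAlgebra R (ℤ × ℤ)).coeff h = 0}
  zero_mem' := fun _ _ => rfl
  add_mem' := by
    intro f f' hf hf' h hne
    simp [hf h hne, hf' h hne]
  neg_mem' := by
    intro f hf h hne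
    simp [hf h hne]

/-- The element `x t₁^r t₂^s` of the extended Rees algebra, for `x ∈ I^r J^s` and `g = (r, s)`. -/
def extendedRees.monomial (I J : Ideal R) (g : ℤ × ℤ) (x : R) (hx : x ∈ bigradedPower I J g) :
    extendedRees I J :=
  ⟨AddMonoidAlgebra.single g x, by
    intro h
    rw [AddMonoidAlgebra.coeff_single, Finsupp.single_apply]
    split_ifs with e
    · rwa [← e]
    · exact Ideal.zero_mem _⟩

/-- The element `a t₁`, for `a ∈ I`. -/
def extendedRees.at₁ {I : Ideal R} (J : Ideal R) {a : R} (ha : a ∈ I) : extendedRees I J :=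
  extendedRees.monomial I J (1, 0) a (by simpa [bigradedPower] using ha)

/-- The element `b t₂`, for `b ∈ J`. -/
def extendedRees.bt₂ (I : Ideal R) {J : Ideal R} {b : R} (hb : b ∈ J) : extendedRees I J :=
  extendedRees.monomial I J (0, 1) b (by simpa [bigradedPower] using hb)

/-- `[H^i_{(at₁, bt₂)}(R')]_g`, as an `R`-module. -/
abbrev extendedRees.localCohomologyComponent {I J : Ideal R} {a b : R} (ha : a ∈ I) (hb : b ∈ J)
    (i : ℕ) (g : ℤ × ℤ) :
    Submodule R ((ModuleCat.restrictScalars (algebraMap R (extendedRees I J))).obj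
      ((localCohomology (Ideal.span {extendedRees.at₁ J ha, extendedRees.bt₂ I hb}) i).obj
        (ModuleCat.of (extendedRees I J) (extendedRees I J)))) :=
  _root_.localCohomologyComponent R (extendedReesGrading I J)
    (Ideal.span {extendedRees.at₁ J ha, extendedRees.bt₂ I hb}) i
    (ModuleCat.of (extendedRees I J) (extendedRees I J)) (extendedReesGrading I J) g

theorem extendedReesGrading_coeff_sum (I J : Ideal R)
    (x : DirectSum (ℤ × ℤ) fun g => extendedReesGrading I J g) (h : ℤ × ℤ) :
    ((DirectSum.coeAddMonoidHom (extendedReesGrading I J) x : extendedRees I J) :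
      AddMonoidAlgebra R (ℤ × ℤ)).coeff h = ((x h : extendedRees I J) : AddMonoidAlgebra R (ℤ × ℤ)).coeff h := by
  induction x using DirectSum.induction_on with
  | zero => simp
  | of g y =>
    rw [DirectSum.coeAddMonoidHom_of]
    by_cases e : g = h
    · subst e; rw [DirectSum.of_eq_same]
    · rw [DirectSum.of_eq_of_ne _ _ _ (Ne.symm e), y.2 h (Ne.symm e)]; rfl
  | add x y hx hy => simp [hx, hy]

/-- The extended Rees algebra is a graded ring (a graded module over itself). -/
theorem extendedReesGrading_isGradedModule (I J : Ideal R) :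
    IsGradedModule (extendedReesGrading I J) (extendedReesGrading I J) where
  isInternal := by
    constructor
    · intro x y hxy
      ext g h
      by_cases e : h = g
      · subst e
        have := congrArg (fun f : extendedRees I J => (f : AddMonoidAlgebra R (ℤ × ℤ)).coeff h) hxy
        simpa [extendedReesGrading_coeff_sum] using this
      · rw [(x g).2 h e, (y g).2 h e]
    · intro f
      classical
      refine ⟨∑ g ∈ (f : AddMonoidAlgebra R (ℤ × ℤ)).coeff.support, DirectSum.of (fun g => extendedReesGrading I J g) g
        ⟨extendedRees.monomial I J g _ (f.2 g), fun h hne => by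
          simp [extendedRees.monomial, hne.symm]⟩, ?_⟩
      apply Subtype.ext
      ext h
      simp [extendedRees.monomial, Finsupp.single_apply]
      grind
  smul_mem := by
    intro g h c m hc hm p hp
    change ((c : AddMonoidAlgebra R (ℤ × ℤ)) * (m : AddMonoidAlgebra R (ℤ × ℤ))).coeff p = 0
    rw [AddMonoidAlgebra.coeff_mul, Finsupp.sum]
    refine Finset.sum_eq_zero fun m₁ _ => ?_
    rw [Finsupp.sum]
    refine Finset.sum_eq_zero fun m₂ _ => ?_
    split_ifs with e
    · by_cases h1 : m₁ = g
      · rw [hm m₂ (by rintro rfl; exact hp (by rw [← e, h1])), mul_zero]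
      · rw [hc m₁ h1, zero_mul]
    · rfl

end ExtendedRees

end

/-! Put A = R', x = at₁, y = bt₂, K = (x, y). The local cohomology module is colim_t Ext²(A/K^t, A),
and (1) is proved by comparing it with the top Čech cohomology colim_k A/(x^k, y^k), while keeping
track of degrees. For a projective resolution P of A/K^t, a comparison map from the Koszul complex
of (x^l, y^l) to P singles out an element e₂ of P₂; a cocycle f : P₂ → A is sent to the fraction
f(e₂)/(xy)^l. Comparison maps are unique up to homotopy, so this depends neither on the lift nor on
the resolution (`exists_extToCech`).

Nothing says that x, y is a regular sequence in A, so a single Koszul complex need not be a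
resolution. Instead A is Noetherian and x is a nonzerodivisor, which makes the first Koszul homology
pro-zero (`exists_koszulProzero`). Hence there are maps in the other direction, from P to a Koszul
complex of lower level (`KoszulColift`), and the two composites agree with the transition maps up to
homotopy and a sign. One composite gives injectivity (`exists_localCohomologyToCech`), the other
shows that each fraction is attained. All choices can be made homogeneous, so classes of degree d
correspond exactly to fractions c/(xy)^k with c of degree k deg x + k deg y + d
(`exists_gradedLocalCohomologyToCech`). For d = (r, s) such c form I^(r+k) J^(s+k), and those in
(x^k, y^k) form a^k I^r J^(s+k) + b^k I^(r+k) J^s (`numInclusion_mem_span_iff`); the colimit is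
therefore that of the L(r, s; k).

In R, the joint reduction equation puts a power of the maximal ideal inside (a, b), so depth 2
forces the first Koszul homology of (a, b) to vanish; by Nakayama a and b are then nonzerodivisors.
For (2), a relation abx = a^(k+1) z + b^(k+1) z' forces b ∣ z and a ∣ z'; for large k the
superficial conditions put the quotients in the required ideals, and cancelling ab finishes. -/

open CategoryTheory

noncomputable section

/-! ### Ext classes represented by cocycles on a projective resolution. -/

section ExtCocycles

variable {A : Type u} [CommRing A]

/-- `ξ ∈ Ext^i(N, M)` is the class of the cocycle `f : P_i ⟶ M`. -/
def IsExtClass {N : ModuleCat.{u} A} (P : ProjectiveResolution N) {M : ModuleCat.{u} A} (i : ℕ)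
    (f : P.complex.X i ⟶ M) (ξ : ((Ext A (ModuleCat.{u} A) i).obj (Opposite.op N)).obj M) : Prop :=
  ∃ z : (P.complex.linearYonedaObj A M).cycles i,
    ((P.complex.linearYonedaObj A M).iCycles i).hom z = f ∧
    (P.isoExt i M).hom.hom ξ = ((P.complex.linearYonedaObj A M).homologyπ i).hom z

variable {N N' : ModuleCat.{u} A} (P : ProjectiveResolution N) (P' : ProjectiveResolution N')
  {M : ModuleCat.{u} A}

theorem IsExtClass.exists_cocycle (i : ℕ)
    (ξ : ((Ext A (ModuleCat.{u} A) i).obj (Opposite.op N)).obj M) :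
    ∃ f, IsExtClass P i f ξ := by
  obtain ⟨z, hz⟩ := (ModuleCat.epi_iff_surjective
    ((P.complex.linearYonedaObj A M).homologyπ i)).1 inferInstance ((P.isoExt i M).hom.hom ξ)
  exact ⟨_, z, rfl, hz.symm⟩

theorem IsExtClass.exists_class (i : ℕ) (f : P.complex.X i ⟶ M)
    (hf : P.complex.d (i + 1) i ≫ f = 0) : ∃ ξ, IsExtClass P i f ξ := by
  have h : ∃ z, ((P.complex.linearYonedaObj A M).iCycles i).hom z = f := by
    have := ShortComplex.exact_of_f_is_kernel (ShortComplex.mk _ _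
      ((P.complex.linearYonedaObj A M).iCycles_d i (i + 1)))
      ((P.complex.linearYonedaObj A M).cyclesIsKernel i (i + 1) (by simp))
    exact (ShortComplex.moduleCat_exact_iff _).1 this f hf
  obtain ⟨z, hz⟩ := h
  refine ⟨(P.isoExt i M).inv.hom (((P.complex.linearYonedaObj A M).homologyπ i).hom z), z, hz, ?_⟩
  simp

theorem IsExtClass.d_comp {P : ProjectiveResolution N} {i : ℕ} {f : P.complex.X i ⟶ M}
    {ξ : ((Ext A (ModuleCat.{u} A) i).obj (Opposite.op N)).obj M} (h : IsExtClass P i f ξ) :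
    P.complex.d (i + 1) i ≫ f = 0 := by
  obtain ⟨z, rfl, -⟩ := h
  have := (P.complex.linearYonedaObj A M).iCycles_d i (i + 1)
  exact congrArg (fun g => g.hom z) this

theorem IsExtClass.eq_zero_iff {P : ProjectiveResolution N} {i : ℕ} {f : P.complex.X (i + 1) ⟶ M}
    {ξ : ((Ext A (ModuleCat.{u} A) (i + 1)).obj (Opposite.op N)).obj M}
    (h : IsExtClass P (i + 1) f ξ) :
    ξ = 0 ↔ ∃ g : P.complex.X i ⟶ M, P.complex.d (i + 1) i ≫ g = f := by
  obtain ⟨z, rfl, hz⟩ := h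
  have hinj := (ModuleCat.mono_iff_injective (P.isoExt (R := A) (i + 1) M).hom).1 inferInstance
  have hi := (ModuleCat.mono_iff_injective
    ((P.complex.linearYonedaObj A M).iCycles (i + 1))).1 inferInstance
  have h0 : ξ = 0 ↔ ((P.complex.linearYonedaObj A M).homologyπ (i + 1)).hom z = 0 := by
    rw [← hz]
    exact (map_eq_zero_iff (P.isoExt (i + 1) M).hom.hom hinj).symm
  rw [h0]
  constructor
  · intro h
    have := ShortComplex.exact_of_g_is_cokernel (ShortComplex.mk _ _
      ((P.complex.linearYonedaObj A M).toCycles_comp_homologyπ i (i + 1)))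
      ((P.complex.linearYonedaObj A M).homologyIsCokernel i (i + 1) (by simp))
    obtain ⟨g, hg⟩ := (ShortComplex.moduleCat_exact_iff _).1 this z h
    refine ⟨g, ?_⟩
    subst hg
    exact (congrArg (fun k => k.hom g) ((P.complex.linearYonedaObj A M).toCycles_i i (i + 1))).symm
  · rintro ⟨g, hg⟩
    have : z = ((P.complex.linearYonedaObj A M).toCycles i (i + 1)).hom g := by
      apply hi
      refine hg.symm.trans ?_
      exact (congrArg (fun k => k.hom g)
        ((P.complex.linearYonedaObj A M).toCycles_i i (i + 1))).symm
    subst this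
    exact congrArg (fun k => k.hom g)
      ((P.complex.linearYonedaObj A M).toCycles_comp_homologyπ i (i + 1))

/-- The map of cochain complexes `Hom(P, M) → Hom(P', M)` induced by a chain map `P' → P`. -/
def linearYonedaObjMap {K K' : ChainComplex (ModuleCat.{u} A) ℕ} (F : K' ⟶ K)
    (M : ModuleCat.{u} A) : K.linearYonedaObj A M ⟶ K'.linearYonedaObj A M :=
  (HomologicalComplex.unopFunctor _ _).map
    (((((linearYoneda A (ModuleCat.{u} A)).obj M).rightOp.mapHomologicalComplex _).map F).op)

theorem comp_square_paste {C : Type*} [Category C] {X X₁ X₂ Y Y₁ Y₂ : C} {e : X ⟶ Y} {p : X ⟶ X₁}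
    {p' : Y ⟶ Y₁} {q : X₁ ⟶ X₂} {q' : Y₁ ⟶ Y₂} {m : X₁ ⟶ Y₁} {n : X₂ ⟶ Y₂}
    (h₁ : e ≫ p' = p ≫ m) (h₂ : m ≫ q' = q ≫ n) : e ≫ p' ≫ q' = (p ≫ q) ≫ n := by
  rw [← Category.assoc, h₁, Category.assoc, h₂, Category.assoc]

theorem iso_inv_square {C : Type*} [Category C] {X X' Y Y' : C} {a : X ≅ Y} {b : X' ≅ Y'}
    {f : X' ⟶ X} {g : Y' ⟶ Y} (h : f ≫ a.hom = b.hom ≫ g) : b.inv ≫ f = g ≫ a.inv := by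
  rw [Iso.inv_comp_eq, ← Category.assoc, ← h, Category.assoc, Iso.hom_inv_id, Category.comp_id]

/-- Ext is the unop of a left derived functor of Hom(-, M) with values in the opposite category. The
square is pasted from naturality of left derived functors and naturality of the passage between
homology and its opposite. -/
theorem isoExt_hom_naturality (P : ProjectiveResolution N) (P' : ProjectiveResolution N') (i : ℕ)
    (g : N' ⟶ N) (F : P'.complex ⟶ P.complex) (hF : F.f 0 ≫ P.π.f 0 = P'.π.f 0 ≫ g) :
    ((Ext A (ModuleCat.{u} A) i).map g.op).app M ≫ (P'.isoExt i M).hom =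
      (P.isoExt i M).hom ≫ HomologicalComplex.homologyMap (linearYonedaObjMap F M) i := by
  have h2 := HomologicalComplex.homologyOp_hom_naturality (linearYonedaObjMap F M) i
  exact comp_square_paste (congrArg Quiver.Hom.unop (P'.isoLeftDerivedObj_inv_naturality g P F hF
    ((linearYoneda A (ModuleCat.{u} A)).obj M).rightOp i))
    (congrArg Quiver.Hom.unop (iso_inv_square h2))

/-- Besides the transition maps of the Ext system, the case where `g` is the identity serves to
change the resolution. -/
theorem IsExtClass.map {P : ProjectiveResolution N} {P' : ProjectiveResolution N'} {i : ℕ}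
    {f : P.complex.X i ⟶ M}
    {ξ : ((Ext A (ModuleCat.{u} A) i).obj (Opposite.op N)).obj M} (h : IsExtClass P i f ξ)
    (g : N' ⟶ N) (F : P'.complex ⟶ P.complex) (hF : F.f 0 ≫ P.π.f 0 = P'.π.f 0 ≫ g) :
    IsExtClass P' i (F.f i ≫ f) ((((Ext A (ModuleCat.{u} A) i).map g.op).app M).hom ξ) := by
  obtain ⟨z, rfl, hz⟩ := h
  refine ⟨(HomologicalComplex.cyclesMap (linearYonedaObjMap F M) i).hom z, ?_, ?_⟩
  · exact congrArg (fun k => k.hom z)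
      (HomologicalComplex.cyclesMap_i (linearYonedaObjMap F M) i)
  · have h1 := congrArg (fun k => k.hom ξ) (isoExt_hom_naturality (M := M) P P' i g F hF)
    have h2 := congrArg (fun k => k.hom z)
      (HomologicalComplex.homologyπ_naturality (linearYonedaObjMap F M) i)
    refine h1.trans (Eq.trans ?_ h2)
    exact congrArg (HomologicalComplex.homologyMap (linearYonedaObjMap F M) i).hom hz

end ExtCocycles

/-! ### Local cohomology as a filtered colimit of Ext modules. -/

section LocalCohomologyColimit

variable {A : Type u} [CommRing A] (K : Ideal A) (i : ℕ) (M : ModuleCat.{u} A)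

/-- The projection `A ⧸ K^t' → A ⧸ K^t` for `t ≤ t'`. -/
def powerQuotientMap {t t' : ℕ} (h : t ≤ t') :
    ModuleCat.of A (A ⧸ K ^ t') ⟶ ModuleCat.of A (A ⧸ K ^ t) :=
  ModuleCat.ofHom (Submodule.mapQ _ _ LinearMap.id (Ideal.pow_le_pow_right h))

/-- The transition map `Ext^i(A ⧸ K^t, M) → Ext^i(A ⧸ K^t', M)`. -/
def extTransition {t t' : ℕ} (h : t ≤ t') :
    ((Ext A (ModuleCat.{u} A) i).obj (Opposite.op (ModuleCat.of A (A ⧸ K ^ t)))).obj M ⟶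
      ((Ext A (ModuleCat.{u} A) i).obj (Opposite.op (ModuleCat.of A (A ⧸ K ^ t')))).obj M :=
  ((Ext A (ModuleCat.{u} A) i).map (powerQuotientMap K h).op).app M

/-- The colimit cocone of the system `Ext^i(A ⧸ K^t, M)` with point `H^i_K(M)`. -/
def localCohomologyCocone : Limits.Cocone
    (localCohomology.diagram (localCohomology.idealPowersDiagram K) i ⋙
      (evaluation (ModuleCat.{u} A) (ModuleCat.{u} A)).obj M) :=
  ((evaluation (ModuleCat.{u} A) (ModuleCat.{u} A)).obj M).mapCocone (Limits.colimit.cocone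
    (localCohomology.diagram (localCohomology.idealPowersDiagram K) i))

def localCohomologyCoconeIsColimit : Limits.IsColimit (localCohomologyCocone K i M) :=
  Limits.isColimitOfPreserves _ (Limits.colimit.isColimit _)

theorem extTransition_extToLocalCohomology {t t' : ℕ} (h : t ≤ t') :
    extTransition K i M h ≫ extToLocalCohomology K i t' M = extToLocalCohomology K i t M :=
  (localCohomologyCocone K i M).w (homOfLE h).op.op

theorem extToLocalCohomology_exists_rep (η : (localCohomology K i).obj M) :
    ∃ t ξ, (extToLocalCohomology K i t M).hom ξ = η := by
  have := Limits.preservesSmallestFilteredColimits_of_preservesFilteredColimits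
    (forget (ModuleCat.{u} A))
  obtain ⟨j, ξ, h⟩ := Limits.Concrete.isColimit_exists_rep _ (localCohomologyCoconeIsColimit K i M) η
  exact ⟨j.unop.unop, ξ, h⟩

theorem localCohomology_exists_desc (C : ModuleCat.{u} A)
    (φ : ∀ t : ℕ, ((Ext A (ModuleCat.{u} A) i).obj
      (Opposite.op (ModuleCat.of A (A ⧸ K ^ t)))).obj M ⟶ C)
    (hφ : ∀ (t t' : ℕ) (h : t ≤ t'), extTransition K i M h ≫ φ t' = φ t) :
    ∃ Φ : (localCohomology K i).obj M ⟶ C, ∀ t, extToLocalCohomology K i t M ≫ Φ = φ t := by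
  let c : Limits.Cocone (localCohomology.diagram (localCohomology.idealPowersDiagram K) i ⋙
      (evaluation (ModuleCat.{u} A) (ModuleCat.{u} A)).obj M) :=
    { pt := C
      ι := { app := fun j => φ j.unop.unop
             naturality := fun j j' f =>
              (hφ j.unop.unop j'.unop.unop (leOfHom f.unop.unop)).trans (Category.comp_id _).symm } }
  exact ⟨(localCohomologyCoconeIsColimit K i M).desc c,
    fun t => (localCohomologyCoconeIsColimit K i M).fac c (Opposite.op (Opposite.op t))⟩

end LocalCohomologyColimit

/-! ### Exactness of a resolution in terms of elements. -/

section ResolutionElements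

variable {A : Type u} [CommRing A] {N : ModuleCat.{u} A}

/-- The augmentation `P_0 → N` of a projective resolution. -/
def CategoryTheory.ProjectiveResolution.augmentation (P : ProjectiveResolution N) :
    P.complex.X 0 ⟶ N :=
  P.π.f 0

variable (P : ProjectiveResolution N)

theorem CategoryTheory.ProjectiveResolution.augmentation_surjective :
    Function.Surjective P.augmentation.hom :=
  (ModuleCat.epi_iff_surjective (P.π.f 0)).1 inferInstance

theorem CategoryTheory.ProjectiveResolution.augmentation_d (q : P.complex.X 1) :
    P.augmentation.hom ((P.complex.d 1 0).hom q) = 0 :=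
  congrArg (fun g => g.hom q) P.complex_d_comp_π_f_zero

theorem CategoryTheory.ProjectiveResolution.exists_d_eq_of_augmentation {p : P.complex.X 0}
    (hp : P.augmentation.hom p = 0) : ∃ q, (P.complex.d 1 0).hom q = p :=
  (ShortComplex.moduleCat_exact_iff _).1 P.exact₀ p hp

theorem CategoryTheory.ProjectiveResolution.d_d (n : ℕ) (q : P.complex.X (n + 2)) :
    (P.complex.d (n + 1) n).hom ((P.complex.d (n + 2) (n + 1)).hom q) = 0 :=
  congrArg (fun g => g.hom q) (P.complex.d_comp_d (n + 2) (n + 1) n)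

theorem CategoryTheory.ProjectiveResolution.exists_d_eq (n : ℕ) {p : P.complex.X (n + 1)}
    (hp : (P.complex.d (n + 1) n).hom p = 0) : ∃ q, (P.complex.d (n + 2) (n + 1)).hom q = p :=
  (ShortComplex.moduleCat_exact_iff _).1 (P.exact_succ n) p hp

end ResolutionElements

/-! ### Top Čech cohomology of a pair of elements. -/

section Cech

variable {A : Type u} [CommRing A] (x y : A)

theorem mul_pow_mul_mem_span_pow {k l : ℕ} (h : k ≤ l) {c : A}
    (hc : c ∈ Ideal.span {x ^ k, y ^ k}) :
    (x * y) ^ (l - k) * c ∈ Ideal.span {x ^ l, y ^ l} := by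
  obtain ⟨u, v, rfl⟩ := Ideal.mem_span_pair.1 hc
  obtain ⟨n, rfl⟩ := Nat.exists_eq_add_of_le h
  refine Ideal.mem_span_pair.2 ⟨y ^ n * u, x ^ n * v, ?_⟩
  rw [Nat.add_sub_cancel_left]
  ring

/-- Multiplication by `(xy)^(l-k)` from `A ⧸ (x^k, y^k)` to `A ⧸ (x^l, y^l)`. -/
def cechTransition (k l : ℕ) (h : k ≤ l) :
    (A ⧸ Ideal.span {x ^ k, y ^ k}) →ₗ[A] (A ⧸ Ideal.span {x ^ l, y ^ l}) :=
  Submodule.mapQ _ _ (LinearMap.lsmul A A ((x * y) ^ (l - k)))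
    (fun _ hc => mul_pow_mul_mem_span_pow x y h hc)

theorem cechTransition_mk (k l : ℕ) (h : k ≤ l) (c : A) :
    cechTransition x y k l h (Ideal.Quotient.mk _ c) =
      Ideal.Quotient.mk _ ((x * y) ^ (l - k) * c) := rfl

/-- The second Čech cohomology `lim_k A ⧸ (x^k, y^k)`. -/
abbrev CechTop : Type u :=
  Module.DirectLimit (fun k : ℕ => A ⧸ Ideal.span {x ^ k, y ^ k}) (cechTransition x y)

instance : DirectedSystem (fun k : ℕ => A ⧸ Ideal.span {x ^ k, y ^ k})
    (fun i j h => cechTransition x y i j h) where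
  map_self i c := by
    obtain ⟨c, rfl⟩ := Ideal.Quotient.mk_surjective c
    rw [cechTransition_mk]
    simp
  map_map k j i hij hjk c := by
    obtain ⟨c, rfl⟩ := Ideal.Quotient.mk_surjective c
    rw [cechTransition_mk, cechTransition_mk, cechTransition_mk, ← mul_assoc, ← pow_add]
    congr 3
    omega

/-- The class of `c / (xy)^k`. -/
def CechTop.mk (k : ℕ) : A →ₗ[A] CechTop x y :=
  (Module.DirectLimit.of A ℕ (fun k : ℕ => A ⧸ Ideal.span {x ^ k, y ^ k})
    (cechTransition x y) k).comp (Submodule.mkQ _)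

theorem CechTop.mk_add (k n : ℕ) (c : A) :
    CechTop.mk x y (k + n) ((x * y) ^ n * c) = CechTop.mk x y k c := by
  have := Module.DirectLimit.of_f (R := A) (ι := ℕ) (G := fun k : ℕ => A ⧸ Ideal.span {x ^ k, y ^ k})
    (f := cechTransition x y) (hij := Nat.le_add_right k n) (x := Ideal.Quotient.mk _ c)
  rw [cechTransition_mk, Nat.add_sub_cancel_left] at this
  exact this

theorem CechTop.mk_eq_zero_of_mem {k : ℕ} {c : A} (h : c ∈ Ideal.span {x ^ k, y ^ k}) :
    CechTop.mk x y k c = 0 := by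
  rw [CechTop.mk, LinearMap.comp_apply, Submodule.mkQ_apply, (Submodule.Quotient.mk_eq_zero _).2 h,
    map_zero]

theorem CechTop.mk_eq_zero {k : ℕ} {c : A} (h : CechTop.mk x y k c = 0) :
    ∃ n, (x * y) ^ n * c ∈ Ideal.span {x ^ (k + n), y ^ (k + n)} := by
  obtain ⟨l, hl, h⟩ := Module.DirectLimit.of.zero_exact h
  obtain ⟨n, rfl⟩ := Nat.exists_eq_add_of_le hl
  refine ⟨n, ?_⟩
  have h' := (cechTransition_mk x y k _ hl c).symm.trans h
  rw [Ideal.Quotient.eq_zero_iff_mem, Nat.add_sub_cancel_left] at h'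
  exact h'

end Cech

/-! ### From Koszul complexes to resolutions: the map from Ext² to Čech cohomology. -/

section KoszulLift

variable {A : Type u} [CommRing A] (x y : A)

/-- A chain map in degrees `≤ 2` from the Koszul complex of `(x^l, y^l)` to a projective resolution
of `A ⧸ J`, given by the images of the basis elements. -/
structure KoszulLift {J : Ideal A} (P : ProjectiveResolution (ModuleCat.of A (A ⧸ J))) (l : ℕ) where
  e₀ : P.complex.X 0
  e₁ : P.complex.X 1
  e₁' : P.complex.X 1
  e₂ : P.complex.X 2
  aug_e₀ : P.augmentation.hom e₀ = Ideal.Quotient.mk J 1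
  d_e₁ : (P.complex.d 1 0).hom e₁ = x ^ l • e₀
  d_e₁' : (P.complex.d 1 0).hom e₁' = y ^ l • e₀
  d_e₂ : (P.complex.d 2 1).hom e₂ = y ^ l • e₁ - x ^ l • e₁'

namespace KoszulLift

variable {x y} {J J' : Ideal A} {P : ProjectiveResolution (ModuleCat.of A (A ⧸ J))}
  {P' : ProjectiveResolution (ModuleCat.of A (A ⧸ J'))}

/-- The Koszul complex is free and P is exact, so basis elements lift degree by degree. No
regularity of x, y enters. -/
theorem nonempty (P : ProjectiveResolution (ModuleCat.of A (A ⧸ J))) {l : ℕ}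
    (hx : x ^ l ∈ J) (hy : y ^ l ∈ J) : Nonempty (KoszulLift x y P l) := by
  obtain ⟨p, hp⟩ := P.augmentation_surjective (Ideal.Quotient.mk J 1)
  have key : ∀ c ∈ J, ∃ q, (P.complex.d 1 0).hom q = c • p := fun c hc => by
    refine P.exists_d_eq_of_augmentation ?_
    rw [map_smul, hp]
    refine (Ideal.Quotient.eq_zero_iff_mem (I := J)).2 (?_ : c * 1 ∈ J)
    rwa [mul_one]
  obtain ⟨q, hq⟩ := key _ hx
  obtain ⟨q', hq'⟩ := key _ hy
  obtain ⟨w, hw⟩ := P.exists_d_eq 0 (p := y ^ l • q - x ^ l • q') (by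
    rw [map_sub, map_smul, map_smul, hq, hq', smul_smul, smul_smul, mul_comm, sub_self])
  exact ⟨⟨p, q, q', w, hp, hq, hq', hw⟩⟩

/-- The composition of a Koszul lift with the transition from level `l + n` to level `l`. -/
def shift {l : ℕ} (T : KoszulLift x y P l) (n : ℕ) : KoszulLift x y P (l + n) where
  e₀ := T.e₀
  e₁ := x ^ n • T.e₁
  e₁' := y ^ n • T.e₁'
  e₂ := (x * y) ^ n • T.e₂
  aug_e₀ := T.aug_e₀
  d_e₁ := by rw [map_smul, T.d_e₁, smul_smul]; ring_nf
  d_e₁' := by rw [map_smul, T.d_e₁', smul_smul]; ring_nf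
  d_e₂ := by rw [map_smul, T.d_e₂, smul_sub, smul_smul, smul_smul, smul_smul, smul_smul]; ring_nf

/-- The image of a Koszul lift under a morphism of resolutions. -/
def map {l : ℕ} (T : KoszulLift x y P' l) (F : P'.complex ⟶ P.complex)
    (hF : P.augmentation.hom ((F.f 0).hom T.e₀) = Ideal.Quotient.mk J 1) :
    KoszulLift x y P l where
  e₀ := (F.f 0).hom T.e₀
  e₁ := (F.f 1).hom T.e₁
  e₁' := (F.f 1).hom T.e₁'
  e₂ := (F.f 2).hom T.e₂
  aug_e₀ := hF
  d_e₁ := by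
    rw [← map_smul, ← T.d_e₁]; exact congrArg (fun g => g.hom T.e₁) (F.comm 1 0)
  d_e₁' := by
    rw [← map_smul, ← T.d_e₁']; exact congrArg (fun g => g.hom T.e₁') (F.comm 1 0)
  d_e₂ := by
    rw [← map_smul, ← map_smul, ← map_sub, ← T.d_e₂]
    exact congrArg (fun g => g.hom T.e₂) (F.comm 2 1)

/-- Two lifts are homotopic, with homotopy given by u, v, v'. Since f kills boundaries from P₃, the
difference of its values is y^l f(v) - x^l f(v'). -/
theorem sub_mem {l : ℕ} (T T' : KoszulLift x y P l) (f : P.complex.X 2 ⟶ ModuleCat.of A A)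
    (hf : P.complex.d 3 2 ≫ f = 0) :
    (f.hom T.e₂ - f.hom T'.e₂ : A) ∈ Ideal.span {x ^ l, y ^ l} := by
  obtain ⟨u, hu⟩ := P.exists_d_eq_of_augmentation (p := T.e₀ - T'.e₀) (by
    rw [map_sub, T.aug_e₀, T'.aug_e₀, sub_self])
  obtain ⟨v, hv⟩ := P.exists_d_eq 0 (p := T.e₁ - T'.e₁ - x ^ l • u) (by
    rw [map_sub, map_sub, map_smul, hu, T.d_e₁, T'.d_e₁, smul_sub, sub_self])
  obtain ⟨v', hv'⟩ := P.exists_d_eq 0 (p := T.e₁' - T'.e₁' - y ^ l • u) (by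
    rw [map_sub, map_sub, map_smul, hu, T.d_e₁', T'.d_e₁', smul_sub, sub_self])
  obtain ⟨s, hs⟩ := P.exists_d_eq 1 (p := T.e₂ - T'.e₂ - y ^ l • v + x ^ l • v') (by
    rw [map_add, map_sub, map_sub, map_smul, map_smul, hv, hv', T.d_e₂, T'.d_e₂]
    module)
  have h0 : f.hom (T.e₂ - T'.e₂ - y ^ l • v + x ^ l • v') = 0 := by
    rw [← hs]; exact congrArg (fun g => g.hom s) hf
  rw [map_add, map_sub, map_sub, map_smul, map_smul] at h0
  refine Ideal.mem_span_pair.2 ⟨-f.hom v', f.hom v, ?_⟩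
  change (f.hom T.e₂ - f.hom T'.e₂ - y ^ l * f.hom v + x ^ l * f.hom v' : A) = 0 at h0
  linear_combination -h0

/-- Shifting a lift by n multiplies `e₂` by (xy)^n, which the colimit absorbs; both lifts can thus
be moved to the common level l + l'. -/
theorem cechMk_eq {l l' : ℕ} (T : KoszulLift x y P l) (T' : KoszulLift x y P l')
    (f : P.complex.X 2 ⟶ ModuleCat.of A A) (hf : P.complex.d 3 2 ≫ f = 0) :
    CechTop.mk x y l (f.hom T.e₂) = CechTop.mk x y l' (f.hom T'.e₂) := by
  have key : ∀ {l l' : ℕ} (T : KoszulLift x y P l) (T' : KoszulLift x y P l') (n n' : ℕ),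
      l + n = l' + n' →
      CechTop.mk x y (l + n) (f.hom (T.shift n).e₂) =
        CechTop.mk x y (l' + n') (f.hom (T'.shift n').e₂) := by
    intro l l' T T' n n' h
    generalize T.shift n = S, T'.shift n' = S'
    generalize l + n = m at *
    subst h
    rw [← sub_eq_zero, ← map_sub]
    exact CechTop.mk_eq_zero_of_mem x y (sub_mem S S' f hf)
  have h := key T T' l' l (Nat.add_comm _ _)
  simp only [shift, map_smul] at h
  rw [← CechTop.mk_add x y l l', ← CechTop.mk_add x y l' l]
  exact (map_smul (CechTop.mk x y (l + l')) _ _).trans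
    (h.trans (map_smul (CechTop.mk x y (l' + l)) _ _).symm)

end KoszulLift

/-- Evaluation at `e₂` sends a coboundary g ∘ d to g(y^l e₁ - x^l e₁'), which lies in (x^l, y^l), so
it descends to cohomology. The map is built on one fixed resolution; its formula on any other comes
from pushing the lift forward along a comparison map. -/
theorem exists_extToCech (J : Ideal A) {l : ℕ} (hx : x ^ l ∈ J) (hy : y ^ l ∈ J) :
    ∃ φ : ((Ext A (ModuleCat.{u} A) 2).obj (Opposite.op (ModuleCat.of A (A ⧸ J)))).obj
        (ModuleCat.of A A) ⟶ ModuleCat.of A (CechTop x y),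
      ∀ (P : ProjectiveResolution (ModuleCat.of A (A ⧸ J))) (l : ℕ) (T : KoszulLift x y P l)
        (f : P.complex.X 2 ⟶ ModuleCat.of A A) (ξ : _), IsExtClass P 2 f ξ →
        φ.hom ξ = CechTop.mk x y l (f.hom T.e₂) := by
  let P₀ := projectiveResolution (ModuleCat.of A (A ⧸ J))
  obtain ⟨T₀⟩ := KoszulLift.nonempty P₀ hx hy
  let ev : (P₀.complex.linearYonedaObj A (ModuleCat.of A A)).X 2 ⟶ ModuleCat.of A A :=
    ModuleCat.ofHom
      { toFun := fun f : P₀.complex.X 2 ⟶ ModuleCat.of A A => f.hom T₀.e₂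
        map_add' := fun _ _ => rfl
        map_smul' := fun _ _ => rfl }
  obtain ⟨ψ, hψ⟩ := Limits.CokernelCofork.IsColimit.desc'
    ((P₀.complex.linearYonedaObj A (ModuleCat.of A A)).homologyIsCokernel 1 2 (by simp))
    ((P₀.complex.linearYonedaObj A (ModuleCat.of A A)).iCycles 2 ≫ ev ≫
      ModuleCat.ofHom (CechTop.mk x y l)) (by
        rw [← Category.assoc, HomologicalComplex.toCycles_i]
        ext (g : P₀.complex.X 1 ⟶ ModuleCat.of A A)
        refine CechTop.mk_eq_zero_of_mem x y (?_ : g.hom ((P₀.complex.d 2 1).hom T₀.e₂) ∈ _)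
        rw [T₀.d_e₂, map_sub, map_smul, map_smul]
        exact Ideal.mem_span_pair.2 ⟨-g.hom T₀.e₁', g.hom T₀.e₁, by
          simp only [smul_eq_mul]; ring⟩)
  refine ⟨(P₀.isoExt 2 _).hom ≫ ψ, fun P l' T f ξ h => ?_⟩
  let F := ProjectiveResolution.lift (𝟙 _) P₀ P
  have hF : F.f 0 ≫ P.π.f 0 = P₀.π.f 0 ≫ 𝟙 (ModuleCat.of A (A ⧸ J)) :=
    ProjectiveResolution.lift_commutes_zero _ _ _
  have h' := h.map (P := P) (P' := P₀) (𝟙 _) F hF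
  have hid : (((Ext A (ModuleCat.{u} A) 2).map (𝟙 (ModuleCat.of A (A ⧸ J))).op).app
      (ModuleCat.of A A)).hom ξ = ξ := by
    rw [op_id, CategoryTheory.Functor.map_id]; rfl
  rw [hid] at h'
  obtain ⟨z, hz, hz'⟩ := h'
  have e1 : ((P₀.isoExt 2 _).hom ≫ ψ).hom ξ =
      CechTop.mk x y l ((F.f 2 ≫ f).hom T₀.e₂) := by
    rw [← hz]
    refine Eq.trans ?_ (congrArg (fun g => g.hom z) hψ)
    exact congrArg ψ.hom hz'
  rw [e1]
  exact KoszulLift.cechMk_eq (T₀.map F ((congrArg (fun g => g.hom T₀.e₀) hF).trans T₀.aug_e₀)) T f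
    h.d_comp

end KoszulLift

/-! ### From resolutions back to Koszul complexes. -/

section KoszulColift

variable {A : Type u} [CommRing A] (x y : A)

theorem exists_linearMap_comp_eq {X Y Z : ModuleCat.{u} A} [Projective X] (f : X →ₗ[A] Y)
    (d : Z →ₗ[A] Y) (h : ∀ p, ∃ z, d z = f p) : ∃ g : X →ₗ[A] Z, ∀ p, d (g p) = f p := by
  have : Module.Projective A X := (IsProjective.iff_projective X).2 ‹_›
  obtain ⟨g, hg⟩ := Module.projective_lifting_property d.rangeRestrict
    (f.codRestrict (LinearMap.range d) h) d.surjective_rangeRestrict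
  exact ⟨g, fun p => congrArg Subtype.val (LinearMap.congr_fun hg p)⟩

/-- Every relation `x^(k+n) u + y^(k+n) v = 0` becomes trivial at level `k`. -/
def KoszulProzero (k n : ℕ) : Prop :=
  ∀ u v : A, x ^ (k + n) * u + y ^ (k + n) * v = 0 → ∃ g, y ^ n * v = x ^ k * g

/-- A map in degrees `≤ 2` from a projective resolution of `A ⧸ J` to the Koszul complex of
`(x^k, y^k)` factoring in degrees `≤ 1` through the Koszul complex of `(x^(k+n), y^(k+n))`. -/
structure KoszulColift {J : Ideal A} (P : ProjectiveResolution (ModuleCat.of A (A ⧸ J)))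
    (k n : ℕ) where
  α : P.complex.X 0 →ₗ[A] A
  β : P.complex.X 1 →ₗ[A] A
  β' : P.complex.X 1 →ₗ[A] A
  γ : P.complex.X 2 →ₗ[A] A
  mk_α : ∀ p, Ideal.Quotient.mk J (α p) = P.augmentation.hom p
  α_d : ∀ q, α ((P.complex.d 1 0).hom q) = x ^ (k + n) * β q + y ^ (k + n) * β' q
  x_γ : ∀ w, x ^ k * γ w = y ^ n * β' ((P.complex.d 2 1).hom w)
  y_γ : ∀ w, y ^ k * γ w = -(x ^ n * β ((P.complex.d 2 1).hom w))

variable {x y}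

/-- The division of a linear map by a nonzerodivisor dividing all its values. -/
theorem exists_linearMap_mul_eq {X : Type*} [AddCommGroup X] [Module A X] {c : A}
    (hc : c ∈ nonZeroDivisors A) (f : X →ₗ[A] A) (h : ∀ p, ∃ g, f p = c * g) :
    ∃ g : X →ₗ[A] A, ∀ p, c * g p = f p := by
  choose g hg using h
  have hinj : ∀ s t, c * s = c * t → s = t := fun s t h => (mul_cancel_left_mem_nonZeroDivisors hc).1 h
  refine ⟨{ toFun := g, map_add' := fun p q => hinj _ _ ?_, map_smul' := fun r p => hinj _ _ ?_ },
    fun p => (hg p).symm⟩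
  · rw [← hg, map_add, hg, hg, mul_add]
  · rw [← hg, map_smul, hg, smul_eq_mul, RingHom.id_apply, smul_eq_mul]; ring

namespace KoszulColift

variable {J J' : Ideal A} {P : ProjectiveResolution (ModuleCat.of A (A ⧸ J))}
  {P' : ProjectiveResolution (ModuleCat.of A (A ⧸ J'))} {k n : ℕ}

/-- There is no choice for γ: pro-vanishing makes y^n β'(dw) divisible by x^k, and the quotient is
unique, hence linear, because x is a nonzerodivisor. The condition involving y^k follows after
multiplication by x^k. -/
theorem exists_of_linearMap (hx : x ∈ nonZeroDivisors A) (hxy : KoszulProzero x y k n)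
    (α : P.complex.X 0 →ₗ[A] A) (β β' : P.complex.X 1 →ₗ[A] A)
    (h₀ : ∀ p, Ideal.Quotient.mk J (α p) = P.augmentation.hom p)
    (h₁ : ∀ q, α ((P.complex.d 1 0).hom q) = x ^ (k + n) * β q + y ^ (k + n) * β' q) :
    ∃ T : KoszulColift x y P k n, T.α = α ∧ T.β = β ∧ T.β' = β' := by
  have h₂ : ∀ w, x ^ (k + n) * β ((P.complex.d 2 1).hom w) +
      y ^ (k + n) * β' ((P.complex.d 2 1).hom w) = 0 := fun w => by
    rw [← h₁, P.d_d 0 w, map_zero]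
  obtain ⟨γ, hγ⟩ := exists_linearMap_mul_eq (pow_mem hx k)
    ((y ^ n) • β'.comp (P.complex.d 2 1).hom) (fun w => hxy _ _ (h₂ w))
  refine ⟨⟨α, β, β', γ, h₀, h₁, hγ, fun w => ?_⟩, rfl, rfl, rfl⟩
  refine (mul_cancel_left_mem_nonZeroDivisors (pow_mem hx k)).1 ?_
  have := hγ w
  simp only [LinearMap.smul_apply, LinearMap.comp_apply, smul_eq_mul] at this
  linear_combination y ^ k * this + h₂ w

variable (T : KoszulColift x y P k n)
include T

theorem γ_d (hx : x ∈ nonZeroDivisors A) (s : P.complex.X 3) :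
    T.γ ((P.complex.d 3 2).hom s) = 0 := by
  refine (mul_cancel_left_mem_nonZeroDivisors (pow_mem hx k)).1 ?_
  rw [T.x_γ, P.d_d 1 s, map_zero, mul_zero, mul_zero]

/-- Lift followed by colift is an endomorphism of Koszul type lifting the identity modulo (x^(k+n),
y^(k+n)), so up to homotopy it is the transition map, which is (xy)^(n+j) in degree 2. The sign
appears because γ and `e₂` follow opposite sign conventions. -/
theorem γ_e₂_sub_mem (hx : x ∈ nonZeroDivisors A) (hxy : KoszulProzero x y k n)
    (hJ : J ≤ Ideal.span {x ^ (k + n), y ^ (k + n)}) (j : ℕ) (S : KoszulLift x y P (k + n + j)) :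
    T.γ S.e₂ + (x * y) ^ (n + j) ∈ Ideal.span {x ^ (k + n + j), y ^ (k + n + j)} := by
  obtain ⟨u, u', hu⟩ : ∃ u u', u * x ^ (k + n) + u' * y ^ (k + n) = T.α S.e₀ - 1 := by
    refine Ideal.mem_span_pair.1 (hJ ?_)
    rw [← Ideal.Quotient.eq, T.mk_α, S.aug_e₀]
  have h1 := T.α_d S.e₁
  have h1' := T.α_d S.e₁'
  rw [S.d_e₁, map_smul, smul_eq_mul] at h1
  rw [S.d_e₁', map_smul, smul_eq_mul] at h1'
  -- Subtracting the values that the transition map would take leaves a Koszul relation at level k +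
  -- n, to which pro-vanishing applies; v and v' are the resulting homotopy.
  obtain ⟨v, hv⟩ := hxy (T.β S.e₁ - x ^ j - x ^ (k + n + j) * u) (T.β' S.e₁ - x ^ (k + n + j) * u')
    (by linear_combination -h1 - x ^ (k + n + j) * hu)
  obtain ⟨v', hv'⟩ := hxy (T.β S.e₁' - y ^ (k + n + j) * u)
    (T.β' S.e₁' - y ^ j - y ^ (k + n + j) * u')
    (by linear_combination -h1' - y ^ (k + n + j) * hu)
  refine Ideal.mem_span_pair.2 ⟨-v', v, ?_⟩
  refine (mul_cancel_left_mem_nonZeroDivisors (pow_mem hx k)).1 ?_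
  have h2 := T.x_γ S.e₂
  rw [S.d_e₂, map_sub, map_smul, map_smul, smul_eq_mul, smul_eq_mul] at h2
  linear_combination -h2 - y ^ (k + n + j) * hv + x ^ (k + n + j) * hv'

theorem cechMk_γ_e₂ (hx : x ∈ nonZeroDivisors A) (hxy : KoszulProzero x y k n)
    (hJ : J ≤ Ideal.span {x ^ (k + n), y ^ (k + n)}) (j : ℕ) (S : KoszulLift x y P (k + n + j))
    (c : A) : CechTop.mk x y (k + n + j) (c * T.γ S.e₂) = -CechTop.mk x y k c := by
  have h := CechTop.mk_eq_zero_of_mem x y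
    (Ideal.mul_mem_left _ c (T.γ_e₂_sub_mem hx hxy hJ j S))
  have e := CechTop.mk_add x y k (n + j) c
  rw [← add_assoc] at e
  rw [mul_add, map_add, mul_comm c ((x * y) ^ _), e] at h
  exact eq_neg_of_add_eq_zero_left h

omit T

/-- Colift followed by lift covers the same map A/J' → A/J as F, hence is homotopic to F. So f ∘ F₂
is cohomologous to -f(e₂) γ, and this is a coboundary when f(e₂) lies in (x^k, y^k), by the two
equations for γ. -/
theorem exists_d_comp_eq (T : KoszulColift x y P' k n) (S : KoszulLift x y P k)
    (g : ModuleCat.of A (A ⧸ J') ⟶ ModuleCat.of A (A ⧸ J))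
    (hg : ∀ c, g.hom (Ideal.Quotient.mk J' c) = Ideal.Quotient.mk J c)
    (F : P'.complex ⟶ P.complex) (hF : F.f 0 ≫ P.augmentation = P'.augmentation ≫ g)
    (f : P.complex.X 2 ⟶ ModuleCat.of A A) (hf : P.complex.d 3 2 ≫ f = 0)
    (hfS : (f.hom S.e₂ : A) ∈ Ideal.span {x ^ k, y ^ k}) :
    ∃ h : P'.complex.X 1 ⟶ ModuleCat.of A A, P'.complex.d 2 1 ≫ h = F.f 2 ≫ f := by
  have comm1 : ∀ q, (P.complex.d 1 0).hom ((F.f 1).hom q) = (F.f 0).hom ((P'.complex.d 1 0).hom q) :=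
    fun q => congrArg (fun g => g.hom q) (F.comm 1 0)
  have comm2 : ∀ q, (P.complex.d 2 1).hom ((F.f 2).hom q) = (F.f 1).hom ((P'.complex.d 2 1).hom q) :=
    fun q => congrArg (fun g => g.hom q) (F.comm 2 1)
  -- The maps h₀, h₁, h₂ form the homotopy; γ enters with a plus sign below because the degree 2
  -- component of the colift is -γ.
  obtain ⟨h₀, hh₀⟩ := exists_linearMap_comp_eq ((F.f 0).hom - T.α.smulRight S.e₀)
    (P.complex.d 1 0).hom (fun p => P.exists_d_eq_of_augmentation (by
      have e1 : P.augmentation.hom ((F.f 0).hom p) = g.hom (P'.augmentation.hom p) :=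
        congrArg (fun g => g.hom p) hF
      rw [LinearMap.sub_apply, LinearMap.smulRight_apply, map_sub, map_smul, S.aug_e₀, e1,
        ← T.mk_α, hg, sub_eq_zero]
      exact congrArg (Ideal.Quotient.mk J) (mul_one (T.α p)).symm))
  obtain ⟨h₁, hh₁⟩ := exists_linearMap_comp_eq ((F.f 1).hom - (x ^ n • T.β).smulRight S.e₁ -
    (y ^ n • T.β').smulRight S.e₁' - h₀.comp (P'.complex.d 1 0).hom)
    (P.complex.d 2 1).hom (fun p => P.exists_d_eq 0 (by
      simp only [LinearMap.sub_apply, LinearMap.smulRight_apply, LinearMap.comp_apply, map_sub,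
        map_smul, S.d_e₁, S.d_e₁', comm1, hh₀, LinearMap.smul_apply, T.α_d]
      module))
  obtain ⟨h₂, hh₂⟩ := exists_linearMap_comp_eq ((F.f 2).hom + T.γ.smulRight S.e₂ -
    h₁.comp (P'.complex.d 2 1).hom)
    (P.complex.d 3 2).hom (fun p => P.exists_d_eq 1 (by
      have e1 := T.x_γ p
      have e2 := T.y_γ p
      have e3 := P'.d_d 0 p
      simp only [Nat.reduceAdd] at e3
      simp only [LinearMap.sub_apply, LinearMap.add_apply, LinearMap.smulRight_apply,
        LinearMap.comp_apply, map_sub, map_add, map_smul, S.d_e₂, comm2, hh₁, e3, map_zero,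
        LinearMap.smul_apply, smul_eq_mul, ← e1, sub_zero]
      rw [eq_neg_iff_add_eq_zero] at e2
      linear_combination (norm := module) congr($e2 • S.e₁)))
  obtain ⟨u, v, huv⟩ := Ideal.mem_span_pair.1 hfS
  -- With f(e₂) = u x^k + v y^k, the product γ f(e₂) equals u y^n β' ∘ d - v x^n β ∘ d; this
  -- dictates the two correction terms.
  refine ⟨ModuleCat.ofHom (f.hom.comp h₁ - (u * y ^ n) • T.β' + (v * x ^ n) • T.β), ?_⟩
  ext w
  have e4 : f.hom ((P.complex.d 3 2).hom (h₂ w)) = 0 := congrArg (fun g => g.hom (h₂ w)) hf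
  rw [hh₂] at e4
  simp only [LinearMap.sub_apply, LinearMap.add_apply, LinearMap.smulRight_apply,
    LinearMap.comp_apply, map_sub, map_add, map_smul, smul_eq_mul] at e4
  have e1 := T.x_γ w
  have e2 := T.y_γ w
  change f.hom (h₁ ((P'.complex.d 2 1).hom w)) - (u * y ^ n) * T.β' ((P'.complex.d 2 1).hom w) +
    (v * x ^ n) * T.β ((P'.complex.d 2 1).hom w) = (f.hom ((F.f 2).hom w) : A)
  linear_combination -e4 - T.γ w * huv + u * e1 + v * e2

end KoszulColift
end KoszulColift

/-! ### Local cohomology embeds into Čech cohomology. -/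

section LocalCohomologyCech

variable {A : Type u} [CommRing A] {x y : A}

/-- Cofinality: it lets colifts to the Koszul complex of (x^m, y^m) start from a resolution of
A/K^(2m). -/
theorem span_pair_pow_le (m : ℕ) : Ideal.span {x, y} ^ (m + m) ≤ Ideal.span {x ^ m, y ^ m} := by
  rw [Ideal.span_insert, Ideal.span_insert]
  refine Ideal.sup_pow_add_le_pow_sup_pow.trans ?_
  rw [Ideal.span_singleton_pow, Ideal.span_singleton_pow]

theorem KoszulColift.nonempty {J : Ideal A} (P : ProjectiveResolution (ModuleCat.of A (A ⧸ J)))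
    {k n : ℕ} (hx : x ∈ nonZeroDivisors A) (hxy : KoszulProzero x y k n)
    (hJ : J ≤ Ideal.span {x ^ (k + n), y ^ (k + n)}) : Nonempty (KoszulColift x y P k n) := by
  obtain ⟨α, hα⟩ := exists_linearMap_comp_eq (X := P.complex.X 0) (Y := ModuleCat.of A (A ⧸ J))
    (Z := ModuleCat.of A A) P.augmentation.hom J.mkQ
    (fun p => J.mkQ_surjective _)
  obtain ⟨b, hb⟩ := exists_linearMap_comp_eq (X := P.complex.X 1) (Y := ModuleCat.of A A)
    (Z := ModuleCat.of A (A × A)) (α.comp (P.complex.d 1 0).hom)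
    ((LinearMap.lsmul A A (x ^ (k + n))).comp (LinearMap.fst A A A) +
      (LinearMap.lsmul A A (y ^ (k + n))).comp (LinearMap.snd A A A)) (fun q => by
    obtain ⟨u, v, huv⟩ := Ideal.mem_span_pair.1 (hJ ((Submodule.Quotient.mk_eq_zero J).1
      ((hα ((P.complex.d 1 0).hom q)).trans (P.augmentation_d q))))
    refine ⟨(u, v), Eq.trans ?_ huv⟩
    simp [mul_comm])
  obtain ⟨T, -⟩ := KoszulColift.exists_of_linearMap hx hxy α ((LinearMap.fst A A A).comp b)
    ((LinearMap.snd A A A).comp b) hα (fun q => (hb q).symm)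
  exact ⟨T⟩

/-- Injectivity: if the fraction f(e₂)/(xy)^t vanishes, then a shifted lift takes values in
(x^(t+j), y^(t+j)), and `KoszulColift.exists_d_comp_eq` makes the pullback of f to a deeper A/K^t' a
coboundary. -/
theorem exists_localCohomologyToCech (hx : x ∈ nonZeroDivisors A)
    (hxy : ∀ k, ∃ n, KoszulProzero x y k n) :
    ∃ Φ : (localCohomology (Ideal.span {x, y}) 2).obj (ModuleCat.of A A) ⟶
        ModuleCat.of A (CechTop x y), Function.Injective Φ.hom ∧
      ∀ (t : ℕ) (P : ProjectiveResolution (ModuleCat.of A (A ⧸ Ideal.span {x, y} ^ t))) (l : ℕ)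
        (T : KoszulLift x y P l) (f : P.complex.X 2 ⟶ ModuleCat.of A A) (ξ : _),
        IsExtClass P 2 f ξ →
        Φ.hom ((extToLocalCohomology (Ideal.span {x, y}) 2 t _).hom ξ) =
          CechTop.mk x y l (f.hom T.e₂) := by
  set K := Ideal.span {x, y} with hK
  have hxK : ∀ t, x ^ t ∈ K ^ t := fun t => Ideal.pow_mem_pow (Ideal.subset_span (by simp)) t
  have hyK : ∀ t, y ^ t ∈ K ^ t := fun t => Ideal.pow_mem_pow (Ideal.subset_span (by simp)) t
  choose φ hφ using fun t => exists_extToCech x y (K ^ t) (hxK t) (hyK t)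
  have hlift : ∀ (t t' : ℕ) (h : t ≤ t'),
      (ProjectiveResolution.lift (powerQuotientMap K h) (projectiveResolution _)
        (projectiveResolution (ModuleCat.of A (A ⧸ K ^ t)))).f 0 ≫
        (projectiveResolution (ModuleCat.of A (A ⧸ K ^ t))).augmentation =
      (projectiveResolution (ModuleCat.of A (A ⧸ K ^ t'))).augmentation ≫ powerQuotientMap K h :=
    fun t t' h => ProjectiveResolution.lift_commutes_zero _ _ _
  obtain ⟨Φ, hΦ⟩ := localCohomology_exists_desc K 2 (ModuleCat.of A A) _ φ (fun t t' h => by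
    ext ξ
    obtain ⟨f, hf⟩ := IsExtClass.exists_cocycle (projectiveResolution _) 2 ξ
    have hf' := hf.map (P' := projectiveResolution _) (powerQuotientMap K h) _ (hlift t t' h)
    obtain ⟨T⟩ := KoszulLift.nonempty (projectiveResolution (ModuleCat.of A (A ⧸ K ^ t')))
      (hxK t') (hyK t')
    have hT : (projectiveResolution (ModuleCat.of A (A ⧸ K ^ t))).augmentation.hom
        (((ProjectiveResolution.lift (powerQuotientMap K h) (projectiveResolution _)
        (projectiveResolution (ModuleCat.of A (A ⧸ K ^ t)))).f 0).hom T.e₀) =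
          Ideal.Quotient.mk _ 1 := by
      refine (congrArg (fun g => g.hom T.e₀) (hlift t t' h)).trans ?_
      exact congrArg (powerQuotientMap K h).hom T.aug_e₀
    exact (hφ t' _ _ T _ _ hf').trans (hφ t _ _ (T.map _ hT) _ _ hf).symm)
  have hΦ' : ∀ t ξ, Φ.hom ((extToLocalCohomology K 2 t _).hom ξ) = (φ t).hom ξ :=
    fun t ξ => congrArg (fun g => g.hom ξ) (hΦ t)
  refine ⟨Φ, ?_, fun t P l T f ξ h => (hΦ' t ξ).trans (hφ t P l T f ξ h)⟩
  rw [injective_iff_map_eq_zero]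
  intro η hη
  obtain ⟨t, ξ, rfl⟩ := extToLocalCohomology_exists_rep K 2 _ η
  obtain ⟨f, hf⟩ := IsExtClass.exists_cocycle (projectiveResolution _) 2 ξ
  obtain ⟨T⟩ := KoszulLift.nonempty (projectiveResolution (ModuleCat.of A (A ⧸ K ^ t)))
    (hxK t) (hyK t)
  rw [hΦ', hφ t _ _ T _ _ hf] at hη
  obtain ⟨j, hj⟩ := CechTop.mk_eq_zero x y hη
  obtain ⟨n, hn⟩ := hxy (t + j)
  -- The target exponent is 2m with m = t + j + n, so that K^(2m) ⊆ (x^m, y^m) and the colift at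
  -- level t + j exists.
  have h : t ≤ (t + j + n) + (t + j + n) := by omega
  obtain ⟨S⟩ := KoszulColift.nonempty (projectiveResolution (ModuleCat.of A
    (A ⧸ K ^ ((t + j + n) + (t + j + n))))) hx hn (span_pair_pow_le _)
  have hf' := hf.map (P' := projectiveResolution _) (powerQuotientMap K h) _ (hlift t _ h)
  have hS := S.exists_d_comp_eq (T.shift j) (powerQuotientMap K h) (fun _ => rfl) _
    (hlift t _ h) f hf.d_comp (by
      refine (congrArg (· ∈ Ideal.span {x ^ (t + j), y ^ (t + j)}) ?_).mp hj
      exact (map_smul f.hom _ _).symm)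
  have h0 : (extTransition K 2 (ModuleCat.of A A) h).hom ξ = 0 := hf'.eq_zero_iff.2 hS
  have h1 := congrArg (fun g => g.hom ξ) (extTransition_extToLocalCohomology K 2 (ModuleCat.of A A) h)
  refine h1.symm.trans ?_
  exact (congrArg _ h0).trans (map_zero (extToLocalCohomology K 2 _ (ModuleCat.of A A)).hom)

end LocalCohomologyCech

/-! ### Gradings handled through their projections. -/

section GradedProjections

variable {G : Type*} [AddCommGroup G] [DecidableEq G]

/-- The maps `pr g` are the projections to the components of the grading `ℳ`. -/
structure IsGradedProjection {M : Type*} [AddCommGroup M] (ℳ : G → AddSubgroup M)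
    (pr : G → M →+ M) : Prop where
  mem : ∀ g m, pr g m ∈ ℳ g
  eq_self : ∀ {g m}, m ∈ ℳ g → pr g m = m
  eq_zero : ∀ {g h m}, m ∈ ℳ h → h ≠ g → pr g m = 0
  iSup_eq_top : ⨆ g, ℳ g = ⊤

namespace IsGradedProjection

variable {M N : Type*} [AddCommGroup M] [AddCommGroup N] {ℳ : G → AddSubgroup M}
  {𝒩 : G → AddSubgroup N} {pr : G → M →+ M} {prN : G → N →+ N}

omit [DecidableEq G] in
theorem induction (h : IsGradedProjection ℳ pr) {p : M → Prop} (m : M)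
    (hom : ∀ g, ∀ m ∈ ℳ g, p m) (add : ∀ m m', p m → p m' → p (m + m')) : p m :=
  AddSubgroup.iSup_induction ℳ (C := p) (h.iSup_eq_top ▸ AddSubgroup.mem_top m) hom
    (hom 0 0 (zero_mem _)) add

theorem exists_eq_sum (h : IsGradedProjection ℳ pr) (m : M) :
    ∃ s : Finset G, ∀ t, s ⊆ t → m = ∑ g ∈ t, pr g m := by
  refine h.induction (p := fun m => ∃ s : Finset G, ∀ t, s ⊆ t → m = ∑ g ∈ t, pr g m) m
    (fun g m hm => ⟨{g}, fun t ht => ?_⟩) ?_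
  · rw [Finset.sum_eq_single_of_mem g (ht (Finset.mem_singleton_self g))
      (fun g' _ hne => h.eq_zero hm hne.symm), h.eq_self hm]
  · rintro m m' ⟨s, hs⟩ ⟨s', hs'⟩
    refine ⟨s ∪ s', fun t ht => ?_⟩
    simp only [map_add, Finset.sum_add_distrib]
    rw [← hs t (Finset.subset_union_left.trans ht), ← hs' t (Finset.subset_union_right.trans ht)]

omit [AddCommGroup G] in
theorem isInternal (h : IsGradedProjection ℳ pr) : DirectSum.IsInternal ℳ := by
  have key : ∀ (x : DirectSum G fun g => ℳ g) (g : G),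
      pr g (DirectSum.coeAddMonoidHom ℳ x) = x g := by
    intro x g
    induction x using DirectSum.induction_on with
    | zero => simp
    | of g' y =>
      rw [DirectSum.coeAddMonoidHom_of]
      by_cases e : g' = g
      · subst e
        rw [DirectSum.of_eq_same, h.eq_self y.2]
      · rw [DirectSum.of_eq_of_ne _ _ _ (Ne.symm e), h.eq_zero y.2 e]; rfl
    | add x y hx hy => simp [hx, hy]
  constructor
  · intro x y hxy
    ext g
    rw [← key x g, ← key y g, hxy]
  · rw [← AddMonoidHom.range_eq_top, ← top_le_iff, ← h.iSup_eq_top]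
    exact iSup_le fun g m hm => ⟨DirectSum.of (fun g => ℳ g) g ⟨m, hm⟩,
      DirectSum.coeAddMonoidHom_of ℳ g ⟨m, hm⟩⟩

omit [AddCommGroup G] in
theorem exists_of_isInternal (h : DirectSum.IsInternal ℳ) :
    ∃ pr : G → M →+ M, IsGradedProjection ℳ pr := by
  classical
  let := h.chooseDecomposition
  refine ⟨fun g => (ℳ g).subtype.comp ((DFinsupp.evalAddMonoidHom g).comp
    (DirectSum.decomposeAddEquiv ℳ).toAddMonoidHom), fun g m => (DirectSum.decompose ℳ m g).2,
    fun {g m} hm => DirectSum.decompose_of_mem_same ℳ hm,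
    fun {g h m} hm hne => DirectSum.decompose_of_mem_ne ℳ hm hne, ?_⟩
  rw [← top_le_iff]
  intro m _
  rw [← DirectSum.sum_support_decompose ℳ m]
  exact sum_mem fun g _ => (le_iSup ℳ g) (DirectSum.decompose ℳ m g).2

/-- Homogeneous additive maps commute with the projections. -/
theorem comm_of_homogeneous (h : IsGradedProjection ℳ pr) (h' : IsGradedProjection 𝒩 prN) {d : G}
    (f : M →+ N) (hf : IsHomogeneousOfDegree ℳ 𝒩 d f) (g : G) (m : M) :
    prN (g + d) (f m) = f (pr g m) := by
  refine h.induction (p := fun m => prN (g + d) (f m) = f (pr g m)) m (fun k m hm => ?_)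
    (fun m m' hm hm' => by simp only [map_add, hm, hm'])
  by_cases e : k = g
  · subst e
    rw [h.eq_self hm, h'.eq_self (hf k m hm)]
  · rw [h.eq_zero hm e, map_zero, h'.eq_zero (hf k m hm) (fun e' => e (add_right_cancel e'))]

theorem exists_preimage (h : IsGradedProjection ℳ pr) (h' : IsGradedProjection 𝒩 prN)
    (f : M →+ N) (hf : IsHomogeneousOfDegree ℳ 𝒩 0 f) {g : G} {m : M} (hm : f m ∈ 𝒩 g) :
    ∃ m' ∈ ℳ g, f m' = f m := by
  refine ⟨pr g m, h.mem g m, ?_⟩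
  rw [← h.comm_of_homogeneous h' f hf, add_zero, h'.eq_self hm]

/-- The grading of a subgroup stable under the projections. -/
theorem restrict (h : IsGradedProjection ℳ pr) (S : AddSubgroup M)
    (hS : ∀ g, ∀ m ∈ S, pr g m ∈ S) :
    IsGradedProjection (fun g => (ℳ g).comap S.subtype)
      (fun g => ((pr g).comp S.subtype).codRestrict S (fun m => hS g m m.2)) where
  mem g m := h.mem g m
  eq_self hm := Subtype.ext (h.eq_self hm)
  eq_zero hm hne := Subtype.ext (h.eq_zero hm hne)
  iSup_eq_top := by
    rw [← top_le_iff]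
    rintro m -
    obtain ⟨s, hs⟩ := h.exists_eq_sum m
    have : m = ∑ g ∈ s, ((pr g).comp S.subtype).codRestrict S (fun m => hS g m m.2) m := by
      apply Subtype.ext
      rw [AddSubgroup.val_finsetSum]
      exact hs s subset_rfl
    rw [this]
    exact sum_mem fun g _ => (le_iSup (fun g => (ℳ g).comap S.subtype) g) (h.mem g m)

omit [AddCommGroup G] [DecidableEq G] in
/-- The grading of the image under a surjection whose kernel is stable under the projections. -/
theorem exists_map (h : IsGradedProjection ℳ pr) (f : M →+ N) (hf : Function.Surjective f)
    (hS : ∀ g m, f m = 0 → f (pr g m) = 0) :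
    ∃ prN : G → N →+ N, IsGradedProjection (fun g => (ℳ g).map f) prN ∧
      ∀ g m, prN g (f m) = f (pr g m) := by
  have hl : ∀ g, f.ker ≤ (f.comp (pr g)).ker := fun g m hm => hS g m hm
  have key : ∀ g m, (AddMonoidHom.liftOfSurjective f hf ⟨f.comp (pr g), hl g⟩) (f m) =
      f (pr g m) := fun g m => AddMonoidHom.liftOfRightInverse_comp_apply f _ _ _ _
  refine ⟨fun g => AddMonoidHom.liftOfSurjective f hf ⟨f.comp (pr g), hl g⟩, ⟨?_, ?_, ?_, ?_⟩, key⟩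
  · intro g n
    obtain ⟨m, rfl⟩ := hf n
    rw [key]
    exact ⟨_, h.mem g m, rfl⟩
  · rintro g _ ⟨m, hm, rfl⟩
    rw [key, h.eq_self hm]
  · rintro g k _ ⟨m, hm, rfl⟩ hne
    rw [key, h.eq_zero hm hne, map_zero]
  · rw [← AddSubgroup.map_iSup, h.iSup_eq_top, ← AddMonoidHom.range_eq_map,
      AddMonoidHom.range_eq_top.2 hf]

end IsGradedProjection
end GradedProjections

/-! ### Homogeneous ideals and homogeneous parts of linear maps. -/

section GradedModules

variable {G : Type*} [AddCommGroup G] [DecidableEq G] {A : Type u} [CommRing A]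
  {𝒜 : G → AddSubgroup A} {prA : G → A →+ A}
  {M N : Type*} [AddCommGroup M] [AddCommGroup N] [Module A M] [Module A N]
  {ℳ : G → AddSubgroup M} {𝒩 : G → AddSubgroup N} {pr : G → M →+ M} {prN : G → N →+ N}

/-- Each component of c • m is a finite sum of products of components. This is the common step
behind homogeneity of products of ideals and of spans of homogeneous elements. -/
theorem IsGradedProjection.smul_mem_of_forall (hA : IsGradedProjection 𝒜 prA)
    (hM : IsGradedProjection ℳ pr)
    (hsmul : ∀ (g h : G) (c : A) (m : M), c ∈ 𝒜 g → m ∈ ℳ h → c • m ∈ ℳ (g + h))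
    (S : AddSubgroup M) {c : A} {m : M} (h : ∀ g g', prA g c • pr g' m ∈ S) (k : G) :
    pr k (c • m) ∈ S := by
  obtain ⟨s, hs⟩ := hA.exists_eq_sum c
  obtain ⟨s', hs'⟩ := hM.exists_eq_sum m
  rw [hs s subset_rfl, hs' s' subset_rfl, Finset.sum_smul, map_sum]
  refine sum_mem fun g _ => ?_
  rw [Finset.smul_sum, map_sum]
  refine sum_mem fun g' _ => ?_
  have hmem := hsmul g g' _ _ (hA.mem g c) (hM.mem g' m)
  by_cases e : g + g' = k
  · subst e
    rw [hM.eq_self hmem]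
    exact h g g'
  · rw [hM.eq_zero hmem e]
    exact zero_mem _

/-- An ideal is homogeneous if it is stable under the projections. -/
def IsStableUnder (prA : G → A →+ A) (K : Ideal A) : Prop := ∀ g, ∀ c ∈ K, prA g c ∈ K

theorem IsStableUnder.mul (hA : IsGradedProjection 𝒜 prA) (h𝒜 : IsGradedModule 𝒜 𝒜)
    {K L : Ideal A} (hK : IsStableUnder prA K) (hL : IsStableUnder prA L) :
    IsStableUnder prA (K * L) := by
  intro g c hc
  induction hc using Submodule.mul_induction_on' with
  | mem_mul_mem m hm n hn =>
    exact hA.smul_mem_of_forall hA h𝒜.smul_mem (K * L).toAddSubgroup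
      (fun g g' => Ideal.mul_mem_mul (hK g m hm) (hL g' n hn)) g
  | add c _ c' _ hc hc' => rw [map_add]; exact add_mem hc hc'

theorem IsStableUnder.pow (hA : IsGradedProjection 𝒜 prA) (h𝒜 : IsGradedModule 𝒜 𝒜)
    {K : Ideal A} (hK : IsStableUnder prA K) (t : ℕ) : IsStableUnder prA (K ^ t) := by
  induction t with
  | zero => rw [pow_zero, Ideal.one_eq_top]; exact fun _ _ _ => Submodule.mem_top
  | succ t ih => rw [pow_succ]; exact ih.mul hA h𝒜 hK

theorem IsStableUnder.span (hA : IsGradedProjection 𝒜 prA) (h𝒜 : IsGradedModule 𝒜 𝒜)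
    {S : Set A} (hS : ∀ c ∈ S, ∃ g, c ∈ 𝒜 g) : IsStableUnder prA (Ideal.span S) := by
  intro g c hc
  induction hc using Submodule.span_induction generalizing g with
  | mem c hc =>
    obtain ⟨h, hh⟩ := hS c hc
    by_cases e : h = g
    · subst e
      rw [hA.eq_self hh]; exact Ideal.subset_span hc
    · rw [hA.eq_zero hh e]; exact zero_mem _
  | zero => rw [map_zero]; exact zero_mem _
  | add c c' _ _ hc hc' => rw [map_add]; exact add_mem (hc g) (hc' g)
  | smul r c _ hc =>
    exact hA.smul_mem_of_forall hA h𝒜.smul_mem (Ideal.span S).toAddSubgroup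
      (fun g g' => Ideal.mul_mem_left _ _ (hc g')) g

omit [AddCommGroup G] [DecidableEq G] in
theorem IsStableUnder.exists_quotientGrading (hA : IsGradedProjection 𝒜 prA)
    {K : Ideal A} (hK : IsStableUnder prA K) :
    ∃ prQ, IsGradedProjection (quotientGrading 𝒜 K) prQ ∧
      ∀ g c, prQ g (Ideal.Quotient.mk K c) = Ideal.Quotient.mk K (prA g c) :=
  hA.exists_map (Ideal.Quotient.mk K).toAddMonoidHom Ideal.Quotient.mk_surjective
    (fun g c hc => Ideal.Quotient.eq_zero_iff_mem.2 (hK g c (Ideal.Quotient.eq_zero_iff_mem.1 hc)))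

theorem isGradedModule_quotientGrading (h𝒜 : IsGradedModule 𝒜 𝒜) (hA : IsGradedProjection 𝒜 prA)
    {K : Ideal A} (hK : IsStableUnder prA K) : IsGradedModule 𝒜 (quotientGrading 𝒜 K) where
  isInternal := (hK.exists_quotientGrading hA).choose_spec.1.isInternal
  smul_mem := by
    rintro g h c _ hc ⟨m, hm, rfl⟩
    exact ⟨c * m, h𝒜.smul_mem g h c m hc hm, rfl⟩

/-- The degree `d` part of a linear map between graded modules. -/
theorem exists_homogeneousPart (h𝒜 : IsGradedProjection 𝒜 prA) (hM : IsGradedModule 𝒜 ℳ)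
    (hN : IsGradedModule 𝒜 𝒩) (hprN : IsGradedProjection 𝒩 prN) (d : G)
    (f : M →ₗ[A] N) :
    ∃ f' : M →ₗ[A] N, ∀ g, ∀ m ∈ ℳ g, f' m = prN (g + d) (f m) := by
  obtain ⟨pr, hpr⟩ := IsGradedProjection.exists_of_isInternal hM.isInternal
  let e := (AddEquiv.ofBijective _ hM.isInternal).symm
  let F : M →+ N := (DirectSum.toAddMonoid fun g =>
    ((prN (g + d)).comp f.toAddMonoidHom).comp (ℳ g).subtype).comp e.toAddMonoidHom
  have hF : ∀ g, ∀ m ∈ ℳ g, F m = prN (g + d) (f m) := by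
    intro g m hm
    have he : e m = DirectSum.of (fun g => ℳ g) g ⟨m, hm⟩ := by
      rw [AddEquiv.symm_apply_eq]
      exact (DirectSum.coeAddMonoidHom_of ℳ g ⟨m, hm⟩).symm
    change DirectSum.toAddMonoid _ (e m) = _
    rw [he, DirectSum.toAddMonoid_of]
    rfl
  refine ⟨{ F with map_smul' := fun c m => ?_ }, hF⟩
  -- By additivity c and m may be taken homogeneous, of degrees g and h; both sides are then the
  -- component of c • f(m) in degree g + h + d.
  change F (c • m) = c • F m
  refine h𝒜.induction (p := fun c => F (c • m) = c • F m) c (fun g c hc => ?_)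
    (fun c c' hc hc' => by rw [add_smul, map_add, hc, hc', add_smul])
  refine hpr.induction (p := fun m => F (c • m) = c • F m) m (fun h m hm => ?_)
    (fun m m' hm hm' => by rw [smul_add, map_add, hm, hm', map_add, smul_add])
  rw [hF _ _ (hM.smul_mem g h c m hc hm), hF h m hm, map_smul]
  have := hprN.comm_of_homogeneous hprN (DistribSMul.toAddMonoidHom N c) (d := g)
    (fun k n hn => by rw [add_comm]; exact hN.smul_mem g k c n hc hn) (h + d) (f m)
  simp only [DistribSMul.toAddMonoidHom_apply] at this
  rw [← this]
  congr 1
  congr 1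
  abel

end GradedModules

/-! ### Graded free resolutions, obtained by iterating the cover by all homogeneous elements. -/

section GradedFree

variable {G : Type} [AddCommGroup G] [DecidableEq G] {A : Type u} [CommRing A]
  (𝒜 : G → AddSubgroup A)

/-- The grading of the free module on generators `i` of degree `deg i`. -/
def freeGrading {ι : Type*} (deg : ι → G) (g : G) : AddSubgroup (ι →₀ A) where
  carrier := {f | ∀ i, f i ∈ 𝒜 (g - deg i)}
  zero_mem' _ := zero_mem _
  add_mem' hf hf' i := add_mem (hf i) (hf' i)
  neg_mem' hf i := neg_mem (hf i)

variable {𝒜}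

omit [DecidableEq G] in
theorem single_mem_freeGrading {ι : Type*} (deg : ι → G) {g : G} {i : ι} {c : A}
    (hc : c ∈ 𝒜 (g - deg i)) : Finsupp.single i c ∈ freeGrading 𝒜 deg g := by
  intro j
  by_cases e : i = j
  · subst e
    rwa [Finsupp.single_eq_same]
  · rw [Finsupp.single_eq_of_ne (Ne.symm e)]
    exact zero_mem _

omit [DecidableEq G] in
theorem isGradedProjection_freeGrading {ι : Type*} {prA : G → A →+ A}
    (hA : IsGradedProjection 𝒜 prA) (deg : ι → G) :
    IsGradedProjection (freeGrading 𝒜 deg) (fun g => Finsupp.liftAddHom fun i =>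
      (Finsupp.singleAddHom i).comp (prA (g - deg i))) := by
  have key : ∀ g (f : ι →₀ A) i, (Finsupp.liftAddHom (fun i =>
      (Finsupp.singleAddHom i).comp (prA (g - deg i))) : (ι →₀ A) →+ (ι →₀ A)) f i =
        prA (g - deg i) (f i) := by
    intro g f i
    induction f using Finsupp.induction_linear with
    | zero => simp
    | add f f' hf hf' => rw [map_add, Finsupp.add_apply, hf, hf', Finsupp.add_apply, map_add]
    | single j c =>
      rw [Finsupp.liftAddHom_apply_single, AddMonoidHom.comp_apply, Finsupp.singleAddHom_apply]
      by_cases e : j = i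
      · subst e
        rw [Finsupp.single_eq_same, Finsupp.single_eq_same]
      · rw [Finsupp.single_eq_of_ne (Ne.symm e), Finsupp.single_eq_of_ne (Ne.symm e), map_zero]
  refine ⟨fun g f i => ?_, fun {g f} hf => ?_, fun {g h f} hf hne => ?_, ?_⟩
  · rw [key]; exact hA.mem _ _
  · ext i
    rw [key, hA.eq_self (hf i)]
  · ext i
    rw [key, hA.eq_zero (hf i) (fun e => hne (sub_left_injective e)), Finsupp.zero_apply]
  · rw [← top_le_iff]
    intro f _
    induction f using Finsupp.induction_linear with
    | zero => exact zero_mem _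
    | add f f' hf hf' => exact add_mem (hf trivial) (hf' trivial)
    | single i c =>
      refine hA.induction (p := fun c => Finsupp.single i c ∈ ⨆ g, freeGrading 𝒜 deg g) c
        (fun g c hc => ?_) (fun c c' hc hc' => by rw [Finsupp.single_add]; exact add_mem hc hc')
      exact (le_iSup (freeGrading 𝒜 deg) (g + deg i))
        (single_mem_freeGrading deg (by rwa [add_sub_cancel_right]))

theorem isGradedModule_freeGrading {ι : Type*} (h𝒜 : IsGradedModule 𝒜 𝒜) (deg : ι → G) :
    IsGradedModule 𝒜 (freeGrading 𝒜 deg) where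
  isInternal := by
    obtain ⟨prA, hA⟩ := IsGradedProjection.exists_of_isInternal h𝒜.isInternal
    exact (isGradedProjection_freeGrading hA deg).isInternal
  smul_mem g h c f hc hf i := by
    rw [Finsupp.smul_apply, add_sub_assoc]
    exact h𝒜.smul_mem _ _ _ _ hc (hf i)

theorem linearCombination_homogeneous {ι M : Type*} [AddCommGroup M] [Module A M]
    {ℳ : G → AddSubgroup M} (hM : IsGradedModule 𝒜 ℳ) (deg : ι → G) (v : ι → M)
    (hv : ∀ i, v i ∈ ℳ (deg i)) :
    IsHomogeneousOfDegree (freeGrading 𝒜 deg) ℳ 0 (Finsupp.linearCombination A v) := by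
  intro g f hf
  rw [Finsupp.linearCombination_apply, Finsupp.sum]
  refine sum_mem fun i _ => ?_
  have := hM.smul_mem _ _ _ _ (hf i) (hv i)
  rwa [sub_add_cancel, ← add_zero g] at this

variable (𝒜)

/-- A graded module over the graded ring `(A, 𝒜)`. -/
structure GradedModuleData where
  carrier : ModuleCat.{u} A
  grading : G → AddSubgroup carrier
  isGraded : IsGradedModule 𝒜 grading

namespace GradedModuleData

variable {𝒜} (X : GradedModuleData 𝒜)

/-- The index set of homogeneous elements. -/
abbrev Index : Type u := Σ g : G, X.grading g

/-- The free module on the homogeneous elements. -/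
abbrev Free : Type u := X.Index →₀ A

/-- The canonical map from the free module on the homogeneous elements. -/
def cover : X.Free →ₗ[A] X.carrier := Finsupp.linearCombination A fun i => (i.2 : X.carrier)

def freeGrading : G → AddSubgroup X.Free := _root_.freeGrading 𝒜 fun i : X.Index => i.1

theorem cover_homogeneous : IsHomogeneousOfDegree X.freeGrading X.grading 0 X.cover :=
  linearCombination_homogeneous X.isGraded _ _ fun i => i.2.2

theorem cover_surjective : Function.Surjective X.cover := by
  obtain ⟨pr, hpr⟩ := IsGradedProjection.exists_of_isInternal X.isGraded.isInternal
  intro m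
  refine hpr.induction (p := fun m => ∃ f, X.cover f = m) m (fun g m hm => ?_) ?_
  · exact ⟨Finsupp.single ⟨g, m, hm⟩ 1, by simp [cover]⟩
  · rintro _ _ ⟨f, rfl⟩ ⟨f', rfl⟩
    exact ⟨f + f', map_add _ _ _⟩

variable (h𝒜 : IsGradedModule 𝒜 𝒜)

/-- The kernel of the canonical cover, as a graded module. -/
def syzygy : GradedModuleData 𝒜 where
  carrier := ModuleCat.of A (LinearMap.ker X.cover)
  grading g := (X.freeGrading g).comap (LinearMap.ker X.cover).toAddSubgroup.subtype
  isGraded :=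
    { isInternal := by
        obtain ⟨pr, hpr⟩ := IsGradedProjection.exists_of_isInternal X.isGraded.isInternal
        obtain ⟨prF, hF⟩ := IsGradedProjection.exists_of_isInternal
          (isGradedModule_freeGrading h𝒜 fun i : X.Index => i.1).isInternal
        refine (hF.restrict (LinearMap.ker X.cover).toAddSubgroup fun g f hf => ?_).isInternal
        have := hF.comm_of_homogeneous hpr X.cover.toAddMonoidHom X.cover_homogeneous g f
        exact this.symm.trans ((congrArg (pr (g + 0)) hf).trans (map_zero _))
      smul_mem := fun g h c m hc hm =>
        (isGradedModule_freeGrading h𝒜 fun i : X.Index => i.1).smul_mem g h c m.1 hc hm }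

/-- The iterated syzygies. -/
def syzygies : ℕ → GradedModuleData 𝒜
  | 0 => X
  | n + 1 => (syzygies n).syzygy h𝒜

/-- The differentials of the graded free resolution. -/
def differential (n : ℕ) : (X.syzygies h𝒜 (n + 1)).Free →ₗ[A] (X.syzygies h𝒜 n).Free :=
  (LinearMap.ker (X.syzygies h𝒜 n).cover).subtype.comp (X.syzygies h𝒜 (n + 1)).cover

theorem differential_exact (n : ℕ) :
    Function.Exact (X.differential h𝒜 n) (X.syzygies h𝒜 n).cover := by
  intro f
  constructor
  · intro hf
    obtain ⟨f', hf'⟩ := (X.syzygies h𝒜 (n + 1)).cover_surjective ⟨f, hf⟩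
    exact ⟨f', congrArg Subtype.val hf'⟩
  · rintro ⟨f', rfl⟩
    exact ((X.syzygies h𝒜 (n + 1)).cover f').2

theorem differential_exact_succ (n : ℕ) :
    Function.Exact (X.differential h𝒜 (n + 1)) (X.differential h𝒜 n) := by
  intro f
  rw [← X.differential_exact h𝒜 (n + 1) f]
  exact ⟨fun h => Subtype.ext h, fun h => congrArg Subtype.val h⟩

theorem differential_homogeneous (n : ℕ) :
    IsHomogeneousOfDegree (X.syzygies h𝒜 (n + 1)).freeGrading (X.syzygies h𝒜 n).freeGrading 0
      (X.differential h𝒜 n) :=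
  fun h m hm => (X.syzygies h𝒜 (n + 1)).cover_homogeneous h m hm

/-- The complex underlying the graded free resolution. -/
def freeComplex : ChainComplex (ModuleCat.{u} A) ℕ :=
  ChainComplex.of (fun n => ModuleCat.of A (X.syzygies h𝒜 n).Free)
    (fun n => ModuleCat.ofHom (X.differential h𝒜 n))
    (fun n => by ext1; exact (X.differential_exact_succ h𝒜 n).linearMap_comp_eq_zero)

theorem freeComplex_d (n : ℕ) :
    (X.freeComplex h𝒜).d (n + 1) n = ModuleCat.ofHom (X.differential h𝒜 n) :=
  ChainComplex.of_d (fun n => ModuleCat.of A (X.syzygies h𝒜 n).Free)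
    (fun n => ModuleCat.ofHom (X.differential h𝒜 n)) n

theorem freeComplex_d_comp_cover :
    (X.freeComplex h𝒜).d 1 0 ≫ (ModuleCat.ofHom X.cover : (X.freeComplex h𝒜).X 0 ⟶ X.carrier) =
      0 := by
  rw [freeComplex_d]
  ext1
  exact (X.differential_exact h𝒜 0).linearMap_comp_eq_zero

/-- The augmentation of the graded free resolution. -/
def freeAugmentation :
    X.freeComplex h𝒜 ⟶ (ChainComplex.single₀ (ModuleCat.{u} A)).obj X.carrier :=
  (ChainComplex.toSingle₀Equiv _ _).symm ⟨ModuleCat.ofHom X.cover, X.freeComplex_d_comp_cover h𝒜⟩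

theorem freeAugmentation_f_zero :
    (X.freeAugmentation h𝒜).f 0 = ModuleCat.ofHom X.cover :=
  ChainComplex.toSingle₀Equiv_symm_apply_f_zero _ _

instance (n : ℕ) : Projective ((X.freeComplex h𝒜).X n) :=
  inferInstanceAs (Projective (ModuleCat.of A (X.syzygies h𝒜 n).Free))

theorem freeComplex_exactAt_succ (n : ℕ) : (X.freeComplex h𝒜).ExactAt (n + 1) := by
  rw [HomologicalComplex.exactAt_iff' _ (n + 1 + 1) (n + 1) n (by simp) (by simp),
    ShortComplex.moduleCat_exact_iff]
  intro f hf
  have h1 := X.freeComplex_d h𝒜 n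
  have h2 := X.freeComplex_d h𝒜 (n + 1)
  obtain ⟨f', hf'⟩ := (X.differential_exact_succ h𝒜 n f).1
    ((congrArg (fun g => g.hom f) h1).symm.trans hf)
  exact ⟨f', (congrArg (fun g => g.hom f') h2).trans hf'⟩

instance : QuasiIso (X.freeAugmentation h𝒜) := ⟨fun n => by
  cases n
  -- In degree 0 the claim is that P₁ → P₀ → N → 0 is exact.
  · rw [ChainComplex.quasiIsoAt₀_iff, ShortComplex.quasiIso_iff_of_zeros']
    · refine (ShortComplex.exact_and_epi_g_iff_of_iso (S₂ := ShortComplex.mk _ _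
        (X.freeComplex_d_comp_cover h𝒜)) ?_).2 ⟨?_, ?_⟩
      · exact ShortComplex.isoMk (Iso.refl _) (Iso.refl _) (Iso.refl _)
          ((Category.id_comp _).trans (Category.comp_id _).symm)
          ((Category.id_comp _).trans
            ((X.freeAugmentation_f_zero h𝒜).symm.trans (Category.comp_id _).symm))
      · rw [ShortComplex.moduleCat_exact_iff]
        intro f hf
        obtain ⟨f', hf'⟩ := (X.differential_exact h𝒜 0 f).1 hf
        exact ⟨f', (congrArg (fun g => g.hom f') (X.freeComplex_d h𝒜 0)).trans hf'⟩
      · exact (ModuleCat.epi_iff_surjective _).2 X.cover_surjective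
    all_goals rfl
  · rw [quasiIsoAt_iff_exactAt']
    · exact X.freeComplex_exactAt_succ h𝒜 _
    · apply ChainComplex.exactAt_succ_single_obj⟩

/-- Every graded module has a graded projective resolution. -/
def freeResolution : GradedProjectiveResolution 𝒜 X.carrier X.grading where
  res := { complex := X.freeComplex h𝒜, π := X.freeAugmentation h𝒜 }
  grading n := (X.syzygies h𝒜 n).freeGrading
  isGraded n := isGradedModule_freeGrading h𝒜 _
  d_homogeneous n := by
    intro h m hm
    rw [freeComplex_d]
    exact X.differential_homogeneous h𝒜 n h m hm
  π_homogeneous := by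
    intro h m hm
    have := congrArg (fun g => g.hom m) (X.freeAugmentation_f_zero h𝒜)
    have h2 := X.cover_homogeneous h m hm
    exact (congrArg (· ∈ X.grading (h + 0)) this).mpr h2

end GradedModuleData
end GradedFree

/-! ### Homogeneous lifts and colifts. -/

section GradedKoszul

variable {G : Type} [AddCommGroup G] [DecidableEq G] {A : Type u} [CommRing A]
  {𝒜 : G → AddSubgroup A} {x y : A} {dx dy : G}

theorem IsGradedModule.pow_mem (h𝒜 : IsGradedModule 𝒜 𝒜) (h1 : (1 : A) ∈ 𝒜 0)
    (hx : x ∈ 𝒜 dx) (n : ℕ) : x ^ n ∈ 𝒜 (n • dx) := by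
  induction n with
  | zero => rwa [pow_zero, zero_smul]
  | succ n ih => rw [pow_succ, succ_nsmul]; exact h𝒜.smul_mem _ _ _ _ ih hx

theorem IsGradedProjection.mul_apply {prA : G → A →+ A} (hA : IsGradedProjection 𝒜 prA)
    (h𝒜 : IsGradedModule 𝒜 𝒜) {d : G} {c : A} (hc : c ∈ 𝒜 d) (g : G) (m : A) :
    prA (g + d) (c * m) = c * prA g m :=
  hA.comm_of_homogeneous hA (AddMonoidHom.mulLeft c)
    (fun h m hm => by rw [add_comm]; exact h𝒜.smul_mem _ _ _ _ hc hm) g m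

variable {J : Ideal A}
  (P : GradedProjectiveResolution 𝒜 (ModuleCat.of A (A ⧸ J)) (quotientGrading 𝒜 J))

/-- At each stage the required boundary (or augmentation value) is homogeneous, so any preimage may
be replaced by its component of that degree. -/
theorem KoszulLift.exists_homogeneous (h𝒜 : IsGradedModule 𝒜 𝒜) (h1 : (1 : A) ∈ 𝒜 0)
    (hJ : IsGradedModule 𝒜 (quotientGrading 𝒜 J)) (hxd : x ∈ 𝒜 dx) (hyd : y ∈ 𝒜 dy) {l : ℕ}
    (hx : x ^ l ∈ J) (hy : y ^ l ∈ J) :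
    ∃ T : KoszulLift x y P.res l, T.e₂ ∈ P.grading 2 (l • dx + l • dy) := by
  obtain ⟨prQ, hQ⟩ := IsGradedProjection.exists_of_isInternal hJ.isInternal
  obtain ⟨pr₀, h₀⟩ := IsGradedProjection.exists_of_isInternal (P.isGraded 0).isInternal
  obtain ⟨pr₁, h₁⟩ := IsGradedProjection.exists_of_isInternal (P.isGraded 1).isInternal
  obtain ⟨pr₂, h₂⟩ := IsGradedProjection.exists_of_isInternal (P.isGraded 2).isInternal
  obtain ⟨S⟩ := KoszulLift.nonempty P.res hx hy
  obtain ⟨p, hp, hp'⟩ := h₀.exists_preimage hQ P.res.augmentation.hom.toAddMonoidHom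
    P.π_homogeneous (g := 0) (m := S.e₀) (by
      refine (congrArg (· ∈ quotientGrading 𝒜 J 0) S.aug_e₀).mpr ?_
      exact ⟨1, h1, rfl⟩)
  have key : ∀ {c d}, c ∈ 𝒜 d → c ∈ J →
      ∃ q ∈ P.grading 1 d, (P.res.complex.d 1 0).hom q = c • p := by
    intro c d hcd hc
    obtain ⟨q, hq⟩ := P.res.exists_d_eq_of_augmentation (p := c • p) (by
      rw [map_smul]
      refine (congrArg (c • ·) (hp'.trans S.aug_e₀)).trans ?_
      refine (Ideal.Quotient.eq_zero_iff_mem (I := J)).2 (?_ : c * 1 ∈ J)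
      rwa [mul_one])
    have hcp := (P.isGraded 0).smul_mem d 0 c p hcd hp
    rw [add_zero] at hcp
    obtain ⟨q', hq', e⟩ := h₁.exists_preimage h₀ (P.res.complex.d 1 0).hom.toAddMonoidHom
      (P.d_homogeneous 0) (g := d) (m := q) ((congrArg (· ∈ P.grading 0 d) hq).mpr hcp)
    exact ⟨q', hq', e.trans hq⟩
  obtain ⟨q, hqd, hq⟩ := key (h𝒜.pow_mem h1 hxd l) hx
  obtain ⟨q', hqd', hq'⟩ := key (h𝒜.pow_mem h1 hyd l) hy
  obtain ⟨w, hw⟩ := P.res.exists_d_eq 0 (p := y ^ l • q - x ^ l • q') (by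
    rw [map_sub, map_smul, map_smul, hq, hq', smul_smul, smul_smul, mul_comm, sub_self])
  have hdw : y ^ l • q - x ^ l • (q' : P.res.complex.X 1) ∈ P.grading 1 (l • dx + l • dy) := by
    refine AddSubgroup.sub_mem _ ?_ ?_
    · rw [add_comm]
      exact (P.isGraded 1).smul_mem _ _ _ _ (h𝒜.pow_mem h1 hyd l) hqd
    · exact (P.isGraded 1).smul_mem _ _ _ _ (h𝒜.pow_mem h1 hxd l) hqd'
  obtain ⟨w', hw', e⟩ := h₂.exists_preimage h₁ (P.res.complex.d 2 1).hom.toAddMonoidHom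
    (P.d_homogeneous 1) (g := l • dx + l • dy) (m := w)
    ((congrArg (· ∈ P.grading 1 (l • dx + l • dy)) hw).mpr hdw)
  exact ⟨⟨p, q, q', w', hp'.trans S.aug_e₀, hq, hq', e.trans hw⟩, hw'⟩

/-- The defining equations survive when α, β, β' are replaced by their parts of degrees 0, -(k+n) dx
and -(k+n) dy. The degree of γ is then automatic: x^k γ = y^n β' ∘ d is homogeneous and x is a
nonzerodivisor. -/
theorem KoszulColift.exists_homogeneous (h𝒜 : IsGradedModule 𝒜 𝒜) (h1 : (1 : A) ∈ 𝒜 0)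
    {prA : G → A →+ A} (hA : IsGradedProjection 𝒜 prA)
    (hJ : IsStableUnder prA J) (hxd : x ∈ 𝒜 dx) (hyd : y ∈ 𝒜 dy)
    {k n : ℕ} (hx : x ∈ nonZeroDivisors A) (hxy : KoszulProzero x y k n)
    (hJK : J ≤ Ideal.span {x ^ (k + n), y ^ (k + n)}) :
    ∃ T : KoszulColift x y P.res k n,
      IsHomogeneousOfDegree (P.grading 2) 𝒜 (-(k • dx + k • dy)) T.γ := by
  obtain ⟨S⟩ := KoszulColift.nonempty P.res hx hxy hJK
  obtain ⟨prQ, hQ, hQA⟩ := hJ.exists_quotientGrading hA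
  obtain ⟨pr₀, h₀⟩ := IsGradedProjection.exists_of_isInternal (P.isGraded 0).isInternal
  obtain ⟨pr₁, h₁⟩ := IsGradedProjection.exists_of_isInternal (P.isGraded 1).isInternal
  obtain ⟨α, hα⟩ := exists_homogeneousPart hA (P.isGraded 0) h𝒜 hA 0 S.α
  obtain ⟨β, hβ⟩ := exists_homogeneousPart hA (P.isGraded 1) h𝒜 hA (-((k + n) • dx)) S.β
  obtain ⟨β', hβ'⟩ := exists_homogeneousPart hA (P.isGraded 1) h𝒜 hA (-((k + n) • dy)) S.β'
  obtain ⟨T, rfl, rfl, rfl⟩ := KoszulColift.exists_of_linearMap (P := P.res) hx hxy α β β'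
    (fun p => by
      refine h₀.induction (p := fun p => Ideal.Quotient.mk J (α p) = P.res.augmentation.hom p) p
        (fun g p hp => ?_) (fun p p' hp hp' => by rw [map_add, map_add, map_add, hp, hp'])
      rw [hα g p hp, ← hQA, S.mk_α]
      exact hQ.eq_self (P.π_homogeneous g p hp))
    (fun q => by
      refine h₁.induction (p := fun q => α ((P.res.complex.d 1 0).hom q) =
          x ^ (k + n) * β q + y ^ (k + n) * β' q) q (fun g q hq => ?_)
        (fun q q' hq hq' => by rw [map_add, map_add, map_add, map_add, hq, hq']; ring)
      have hd := P.d_homogeneous 0 g q hq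
      rw [hα _ _ hd, S.α_d, hβ g q hq, hβ' g q hq,
        ← hA.mul_apply h𝒜 (h𝒜.pow_mem h1 hxd (k + n)),
        ← hA.mul_apply h𝒜 (h𝒜.pow_mem h1 hyd (k + n)), neg_add_cancel_right, neg_add_cancel_right,
        add_zero, add_zero, map_add])
  refine ⟨T, fun g w hw => ?_⟩
  have hy' : y ^ n * T.β' ((P.res.complex.d 2 1).hom w) ∈ 𝒜 (g - k • dy) := by
    have hd := P.d_homogeneous 1 g w hw
    have h := hA.mem (g + 0 + -((k + n) • dy)) (S.β' ((P.res.complex.d 2 1).hom w))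
    rw [← hβ' _ _ hd] at h
    have := h𝒜.smul_mem _ _ _ _ (h𝒜.pow_mem h1 hyd n) h
    rwa [show n • dy + (g + 0 + -((k + n) • dy)) = g - k • dy by rw [add_smul]; abel] at this
  rw [← T.x_γ] at hy'
  have e := hA.mul_apply h𝒜 (h𝒜.pow_mem h1 hxd k) (g + -(k • dx + k • dy)) (T.γ w)
  rw [show g + -(k • dx + k • dy) + k • dx = g - k • dy by abel, hA.eq_self hy'] at e
  rw [(mul_cancel_left_mem_nonZeroDivisors (_root_.pow_mem hx k)).1 e]
  exact hA.mem _ _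

end GradedKoszul

/-! ### Homogeneous classes correspond to homogeneous fractions. -/

section GradedLocalCohomologyCech

variable {G : Type} [AddCommGroup G] [DecidableEq G] {A : Type u} [CommRing A]
  {𝒜 : G → AddSubgroup A} {x y : A} {dx dy : G}

/-- The map from local cohomology to Čech cohomology identifies the homogeneous classes. -/
theorem exists_gradedLocalCohomologyToCech (h𝒜 : IsGradedModule 𝒜 𝒜) (h1 : (1 : A) ∈ 𝒜 0)
    (hxd : x ∈ 𝒜 dx) (hyd : y ∈ 𝒜 dy) (hx : x ∈ nonZeroDivisors A)
    (hxy : ∀ k, ∃ n, KoszulProzero x y k n) :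
    ∃ Φ : (localCohomology (Ideal.span {x, y}) 2).obj (ModuleCat.of A A) ⟶
        ModuleCat.of A (CechTop x y), Function.Injective Φ.hom ∧
      ∀ (d : G) (η : CechTop x y),
        (∃ (t : ℕ) (ξ : ((Ext A (ModuleCat.{u} A) 2).obj
            (Opposite.op (ModuleCat.of A (A ⧸ Ideal.span {x, y} ^ t)))).obj (ModuleCat.of A A)),
          IsHomogeneousExtClass 𝒜 (quotientGrading 𝒜 (Ideal.span {x, y} ^ t)) 𝒜 2 d ξ ∧
          Φ.hom ((extToLocalCohomology (Ideal.span {x, y}) 2 t _).hom ξ) = η) ↔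
        ∃ (k : ℕ), ∃ c ∈ 𝒜 (k • dx + k • dy + d), CechTop.mk x y k c = η := by
  obtain ⟨Φ, hΦ, H⟩ := exists_localCohomologyToCech hx hxy
  obtain ⟨prA, hA⟩ := IsGradedProjection.exists_of_isInternal h𝒜.isInternal
  have hK : ∀ t, IsStableUnder prA (Ideal.span {x, y} ^ t) :=
    IsStableUnder.pow hA h𝒜 (IsStableUnder.span hA h𝒜 (by
      rintro c (rfl | rfl)
      exacts [⟨_, hxd⟩, ⟨_, hyd⟩]))
  have hxK : ∀ t, x ^ t ∈ Ideal.span {x, y} ^ t :=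
    fun t => Ideal.pow_mem_pow (Ideal.subset_span (by simp)) t
  have hyK : ∀ t, y ^ t ∈ Ideal.span {x, y} ^ t :=
    fun t => Ideal.pow_mem_pow (Ideal.subset_span (by simp)) t
  refine ⟨Φ, hΦ, fun d η => ⟨?_, ?_⟩⟩
  · rintro ⟨t, ξ, ⟨P, z, f, hz, hf, hξ⟩, rfl⟩
    obtain ⟨T, hT⟩ := KoszulLift.exists_homogeneous P h𝒜 h1
      (isGradedModule_quotientGrading h𝒜 hA (hK t)) hxd hyd (hxK t) (hyK t)
    exact ⟨t, f.hom T.e₂, hf _ _ hT, (H t P.res t T f ξ ⟨z, hz, hξ⟩).symm⟩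
  · rintro ⟨k, c, hc, rfl⟩
    obtain ⟨n, hn⟩ := hxy k
    let X : GradedModuleData 𝒜 := ⟨ModuleCat.of A (A ⧸ Ideal.span {x, y} ^ (k + n + (k + n))),
      quotientGrading 𝒜 _, isGradedModule_quotientGrading h𝒜 hA (hK _)⟩
    let P : GradedProjectiveResolution 𝒜
      (ModuleCat.of A (A ⧸ Ideal.span {x, y} ^ (k + n + (k + n)))) (quotientGrading 𝒜 _) :=
      X.freeResolution h𝒜
    obtain ⟨T, hT⟩ := KoszulColift.exists_homogeneous P h𝒜 h1 hA (hK _) hxd hyd hx hn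
      (span_pair_pow_le _)
    obtain ⟨S⟩ := KoszulLift.nonempty P.res (hxK _) (hyK _)
    -- The cocycle -cγ represents c/(xy)^k: evaluated on a lift, γ gives -(xy)^(level - k) modulo
    -- the ideal, so the two signs cancel.
    let f : P.res.complex.X 2 ⟶ ModuleCat.of A A := ModuleCat.ofHom (-c • T.γ)
    have hf : ∀ w, f.hom w = (-c * T.γ w : A) := fun _ => rfl
    obtain ⟨ξ, hξ⟩ := IsExtClass.exists_class P.res 2 f (by
      ext s
      change -c * T.γ ((P.res.complex.d 3 2).hom s) = 0
      rw [T.γ_d hx, mul_zero])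
    refine ⟨_, ξ, ⟨P, hξ.choose, f, hξ.choose_spec.1, fun g w hw => ?_, hξ.choose_spec.2⟩, ?_⟩
    · have := h𝒜.smul_mem _ _ _ _ (neg_mem hc) (hT g w hw)
      rw [show k • dx + k • dy + d + (g + -(k • dx + k • dy)) = g + d by abel] at this
      exact this
    · rw [H _ P.res _ S f ξ hξ]
      change CechTop.mk x y _ (-c * T.γ S.e₂) = _
      rw [T.cechMk_γ_e₂ hx hn (span_pair_pow_le _) (k + n) S, map_neg, neg_neg]

end GradedLocalCohomologyCech

/-! ### Pro-vanishing of Koszul homology over a Noetherian ring. -/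

section Prozero

variable {A : Type*} [CommRing A]

/-- The chain of colon ideals (x^k : y^n) stabilises at some n. A relation at level k + n puts v in
(x^k : y^(k+n)), which equals (x^k : y^n). -/
theorem exists_koszulProzero [IsNoetherianRing A] (x y : A) (k : ℕ) :
    ∃ n, KoszulProzero x y k n := by
  let C : ℕ →o Ideal A :=
    { toFun := fun n => Submodule.comap (LinearMap.lsmul A A (y ^ n)) (Ideal.span {x ^ k})
      monotone' := monotone_nat_of_le_succ fun n v hv => by
        have : y * (y ^ n * v) ∈ Ideal.span {x ^ k} := Ideal.mul_mem_left _ y hv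
        rwa [← mul_assoc, ← pow_succ'] at this }
  obtain ⟨n, hn⟩ := monotone_stabilizes_iff_noetherian.2 inferInstance C
  refine ⟨n, fun u v h => ?_⟩
  have hv : v ∈ C (k + n) := by
    refine Ideal.mem_span_singleton.2 (⟨-(x ^ n * u), ?_⟩ : x ^ k ∣ y ^ (k + n) * v)
    linear_combination h
  rw [← hn (k + n) (Nat.le_add_left n k)] at hv
  exact Ideal.mem_span_singleton.1 hv

end Prozero

/-! ### Homogeneous elements and Noetherianity of the extended Rees algebra. -/

namespace extendedRees

variable {R : Type u} [CommRing R] {I J : Ideal R} {a b : R}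

theorem one_mem_grading : (1 : extendedRees I J) ∈ extendedReesGrading I J 0 := by
  intro h hne
  change (1 : AddMonoidAlgebra R (ℤ × ℤ)).coeff h = 0
  rw [AddMonoidAlgebra.one_def, AddMonoidAlgebra.coeff_single, Finsupp.single_eq_of_ne hne]

theorem monomial_mem_grading (g : ℤ × ℤ) (c : R) (hc : c ∈ bigradedPower I J g) :
    monomial I J g c hc ∈ extendedReesGrading I J g := by
  intro h hne
  rw [monomial, AddMonoidAlgebra.coeff_single, Finsupp.single_eq_of_ne hne]

theorem eq_monomial_of_mem_grading {g : ℤ × ℤ} {f : extendedRees I J}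
    (hf : f ∈ extendedReesGrading I J g) :
    f = monomial I J g ((f : AddMonoidAlgebra R (ℤ × ℤ)).coeff g) (f.2 g) := by
  apply Subtype.ext
  ext h
  rw [monomial, AddMonoidAlgebra.coeff_single]
  by_cases e : h = g
  · subst e
    rw [Finsupp.single_eq_same]
  · rw [Finsupp.single_eq_of_ne e, hf h e]

theorem coeff_monomial_mul (g h : ℤ × ℤ) (c : R) (hc : c ∈ bigradedPower I J g)
    (f : extendedRees I J) :
    ((monomial I J g c hc * f : extendedRees I J) : AddMonoidAlgebra R (ℤ × ℤ)).coeff (g + h) =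
      c * (f : AddMonoidAlgebra R (ℤ × ℤ)).coeff h :=
  AddMonoidAlgebra.coeff_single_mul_eq_mul_coeff h (fun _ _ => add_right_inj g)

theorem coeff_monomial_pow_mul (g h : ℤ × ℤ) (c : R) (hc : c ∈ bigradedPower I J g) (n : ℕ)
    (f : extendedRees I J) :
    ((monomial I J g c hc ^ n * f : extendedRees I J) : AddMonoidAlgebra R (ℤ × ℤ)).coeff
      (n • g + h) = c ^ n * (f : AddMonoidAlgebra R (ℤ × ℤ)).coeff h := by
  change ((AddMonoidAlgebra.single g c ^ n * f : AddMonoidAlgebra R (ℤ × ℤ))).coeff _ = _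
  rw [AddMonoidAlgebra.single_pow]
  exact AddMonoidAlgebra.coeff_single_mul_eq_mul_coeff h (fun _ _ => add_right_inj (n • g))

theorem monomial_mem_nonZeroDivisors (g : ℤ × ℤ) {c : R} (hc : c ∈ bigradedPower I J g)
    (h : c ∈ nonZeroDivisors R) : monomial I J g c hc ∈ nonZeroDivisors (extendedRees I J) := by
  rw [mem_nonZeroDivisors_iff_right]
  intro f hf
  apply Subtype.ext
  ext k
  have := coeff_monomial_mul g k c hc f
  rw [mul_comm, hf] at this
  exact (mul_left_mem_nonZeroDivisors_eq_zero_iff h).1 this.symm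

theorem at₁_mem_grading (ha : a ∈ I) : at₁ J ha ∈ extendedReesGrading I J (1, 0) :=
  monomial_mem_grading _ _ _

theorem bt₂_mem_grading (hb : b ∈ J) : bt₂ I hb ∈ extendedReesGrading I J (0, 1) :=
  monomial_mem_grading _ _ _

/-- Generators are t₁⁻¹, t₂⁻¹ and the multiples of t₁ and t₂ by finite generating sets of I and J.
-/
theorem fg [IsNoetherianRing R] : (extendedRees I J).FG := by
  classical
  obtain ⟨sI, hI⟩ := (isNoetherianRing_iff_ideal_fg R).1 inferInstance I
  obtain ⟨sJ, hJ⟩ := (isNoetherianRing_iff_ideal_fg R).1 inferInstance J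
  let S : Finset (AddMonoidAlgebra R (ℤ × ℤ)) :=
    {AddMonoidAlgebra.single (-1, 0) 1, AddMonoidAlgebra.single (0, -1) 1} ∪
      (sI.image (AddMonoidAlgebra.single (1, 0)) ∪ sJ.image (AddMonoidAlgebra.single (0, 1)))
  set B := Algebra.adjoin R (S : Set (AddMonoidAlgebra R (ℤ × ℤ))) with hB
  have hS : ∀ f ∈ S, f ∈ B := fun f hf => Algebra.subset_adjoin hf
  have hspan : ∀ (s : Finset R) (g : ℤ × ℤ), (∀ c ∈ s, AddMonoidAlgebra.single g c ∈ B) →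
      ∀ c ∈ Ideal.span (s : Set R), AddMonoidAlgebra.single g c ∈ B := by
    intro s g hs c hc
    induction hc using Submodule.span_induction with
    | mem c hc => exact hs c hc
    | zero => rw [AddMonoidAlgebra.single_zero]; exact zero_mem _
    | add c d _ _ hc hd => rw [AddMonoidAlgebra.single_add]; exact add_mem hc hd
    | smul r c _ hc => rw [← AddMonoidAlgebra.smul_single]; exact B.smul_mem hc r
  have hprod : ∀ (K L : Ideal R) (g h : ℤ × ℤ), (∀ c ∈ K, AddMonoidAlgebra.single g c ∈ B) →
      (∀ c ∈ L, AddMonoidAlgebra.single h c ∈ B) →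
      ∀ c ∈ K * L, AddMonoidAlgebra.single (g + h) c ∈ B := by
    intro K L g h hK hL c hc
    refine Submodule.mul_induction_on hc (fun c hc d hd => ?_) fun c d hc hd => ?_
    · rw [← AddMonoidAlgebra.single_mul_single]
      exact mul_mem (hK c hc) (hL d hd)
    · rw [AddMonoidAlgebra.single_add]; exact add_mem hc hd
  have hpow : ∀ (K : Ideal R) (g : ℤ × ℤ), (∀ c ∈ K, AddMonoidAlgebra.single g c ∈ B) →
      ∀ n : ℕ, ∀ c ∈ K ^ n, AddMonoidAlgebra.single (n • g) c ∈ B := by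
    intro K g hK n
    induction n with
    | zero =>
      intro c _
      rw [zero_smul]
      exact B.algebraMap_mem c
    | succ n ih =>
      rw [pow_succ, succ_nsmul]
      exact hprod _ _ _ _ ih hK
  have h1 := hpow I (1, 0) (hI ▸ hspan sI _ fun c hc => hS _ (by
    simp only [S, Finset.mem_union, Finset.mem_image]; exact Or.inr (Or.inl ⟨c, hc, rfl⟩)))
  have h2 := hpow J (0, 1) (hJ ▸ hspan sJ _ fun c hc => hS _ (by
    simp only [S, Finset.mem_union, Finset.mem_image]; exact Or.inr (Or.inr ⟨c, hc, rfl⟩)))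
  have htop : ∀ g : ℤ × ℤ, AddMonoidAlgebra.single g (1 : R) ∈ B →
      ∀ c ∈ (⊤ : Ideal R), AddMonoidAlgebra.single g c ∈ B := by
    intro g hg c _
    have := B.smul_mem hg c
    rwa [AddMonoidAlgebra.smul_single, smul_eq_mul, mul_one] at this
  have h3 := hpow ⊤ (-1, 0) (htop _ (hS _ (by simp [S])))
  have h4 := hpow ⊤ (0, -1) (htop _ (hS _ (by simp [S])))
  refine ⟨S, le_antisymm (Algebra.adjoin_le ?_) ?_⟩
  · intro f hf
    simp only [S, Finset.coe_union, Finset.coe_insert, Finset.coe_singleton, Finset.coe_image] at hf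
    have hmem : ∀ g c, c ∈ bigradedPower I J g →
        AddMonoidAlgebra.single g c ∈ extendedRees I J :=
      fun g c hc => (monomial I J g c hc).2
    rcases hf with (rfl | rfl) | ⟨c, hc, rfl⟩ | ⟨c, hc, rfl⟩
    · exact hmem _ _ (by simp [bigradedPower])
    · exact hmem _ _ (by simp [bigradedPower])
    · exact hmem _ _ (by simpa [bigradedPower] using hI ▸ Ideal.subset_span hc)
    · exact hmem _ _ (by simpa [bigradedPower] using hJ ▸ Ideal.subset_span hc)
  · intro f hf
    have hmono : ∀ g, ∀ c ∈ bigradedPower I J g, AddMonoidAlgebra.single g c ∈ B := by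
      intro g c hc
      -- Each exponent is split into positive and negative parts: the coefficient is carried by the
      -- positive powers, while the negative ones have the unit ideal as coefficients.
      have h5 := hprod _ _ _ _ (hprod _ _ _ _ (h1 g.1.toNat) (h2 g.2.toNat))
        (hprod _ _ _ _ (h3 (-g.1).toNat) (h4 (-g.2).toNat)) c (by
          rwa [Ideal.top_pow, Ideal.top_pow, Ideal.mul_top, Ideal.mul_top])
      convert h5 using 2
      ext <;> simp <;> omega
    have : f = ∑ g ∈ f.coeff.support, AddMonoidAlgebra.single g (f.coeff g) := by
      ext h
      simp [Finsupp.single_apply]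
    rw [this]
    exact sum_mem fun g _ => hmono g _ (hf g)

theorem isNoetherianRing [IsNoetherianRing R] : IsNoetherianRing (extendedRees I J) :=
  isNoetherianRing_of_fg fg

end extendedRees

/-! ### Koszul acyclicity of a pair of ring elements. -/

section RegularPairs

variable {R : Type*} [CommRing R]

/-- The first Koszul homology of `(a, b)` vanishes. -/
def KoszulAcyclic (a b : R) : Prop :=
  ∀ u v, a * u + b * v = 0 → ∃ w, u = b * w ∧ v = -(a * w)

theorem KoszulAcyclic.symm {a b : R} (h : KoszulAcyclic a b) : KoszulAcyclic b a := by
  intro u v e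
  obtain ⟨w, hv, hu⟩ := h v u (by rw [add_comm, e])
  exact ⟨-w, by rw [hu]; ring, by rw [hv]; ring⟩

theorem KoszulAcyclic.dvd_of_mul {a b : R} (h : KoszulAcyclic a b) {v : R} (hv : a ∣ b * v) :
    a ∣ v := by
  obtain ⟨u, hu⟩ := hv
  obtain ⟨w, -, hw⟩ := h (-u) v (by rw [hu]; ring)
  exact ⟨-w, by rw [hw]; ring⟩

theorem dvd_of_pow_mul {a b : R} (h : ∀ v, a ∣ b * v → a ∣ v) (n : ℕ) {v : R}
    (hv : a ∣ b ^ n * v) : a ∣ v := by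
  induction n generalizing v with
  | zero => rwa [pow_zero, one_mul] at hv
  | succ n ih =>
    rw [pow_succ, mul_assoc] at hv
    exact h v (ih hv)

theorem pow_dvd_of_mul {c d : R} (hc : c ∈ nonZeroDivisors R) (h : ∀ v, c ∣ d * v → c ∣ v) (n : ℕ)
    {v : R} (hv : c ^ n ∣ d * v) : c ^ n ∣ v := by
  induction n generalizing v with
  | zero => rw [pow_zero]; exact one_dvd v
  | succ n ih =>
    obtain ⟨v', rfl⟩ := h v ((dvd_pow_self c n.succ_ne_zero).trans hv)
    obtain ⟨w, hw⟩ := hv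
    rw [pow_succ'] at hw ⊢
    refine mul_dvd_mul_left c (ih ⟨w, (mul_cancel_left_mem_nonZeroDivisors hc).1 ?_⟩)
    linear_combination hw

/-- Depth sensitivity of the Koszul complex in length two. -/
theorem koszulAcyclic_of_mem_span {a b c d : R} (hc : c ∈ nonZeroDivisors R)
    (hcd : ∀ v, c ∣ d * v → c ∣ v) (hc' : c ∈ Ideal.span {a, b}) (hd' : d ∈ Ideal.span {a, b}) :
    KoszulAcyclic a b := by
  obtain ⟨α, β, hαβ⟩ := Ideal.mem_span_pair.1 hc'
  obtain ⟨γ, δ, hγδ⟩ := Ideal.mem_span_pair.1 hd'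
  intro u v huv
  -- On a relation au + bv = 0 one has cu = b(βu - αv) and cv = -a(βu - αv), so the wanted w is (βu
  -- - αv)/c. Divisibility by c comes from regularity of d modulo c, through d(βu - αv) = c(δu -
  -- γv).
  have hz : d * (β * u - α * v) - c * (δ * u - γ * v) = 0 := by
    rw [← hαβ, ← hγδ]
    linear_combination (β * γ - α * δ) * huv
  obtain ⟨w, hw⟩ := hcd (β * u - α * v) ⟨δ * u - γ * v, sub_eq_zero.1 hz⟩
  refine ⟨w, (mul_cancel_left_mem_nonZeroDivisors hc).1 ?_,
    (mul_cancel_left_mem_nonZeroDivisors hc).1 ?_⟩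
  · linear_combination b * hw - u * hαβ + α * huv
  · linear_combination -a * hw - v * hαβ + β * huv

/-- If au = 0, acyclicity gives u = bw with aw = 0. The annihilator N of a thus satisfies N ⊆ bN,
and Nakayama gives N = 0. -/
theorem KoszulAcyclic.mem_nonZeroDivisors [IsLocalRing R] [IsNoetherianRing R] {a b : R}
    (h : KoszulAcyclic a b) (hb : b ∈ IsLocalRing.maximalIdeal R) : a ∈ nonZeroDivisors R := by
  let N : Ideal R := LinearMap.ker (LinearMap.lsmul R R a)
  have hN : N = ⊥ := by
    refine Submodule.eq_bot_of_le_smul_of_le_jacobson_bot (Ideal.span {b}) N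
      (IsNoetherian.noetherian N) (fun u hu => ?_) ?_
    · have hu' : a * u = 0 := hu
      obtain ⟨w, rfl, hw⟩ := h u 0 (by rw [hu', mul_zero, add_zero])
      exact Ideal.mul_mem_mul (Ideal.mem_span_singleton_self b)
        (show w ∈ N from neg_eq_zero.1 hw.symm)
    · rw [IsLocalRing.jacobson_eq_maximalIdeal ⊥ bot_ne_top, Ideal.span_singleton_le_iff_mem]
      exact hb
  rw [mem_nonZeroDivisors_iff_right]
  intro u hu
  have : u ∈ N := show a * u = 0 by rw [mul_comm, hu]
  rwa [hN] at this

end RegularPairs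

/-! ### Joint reductions in a Cohen-Macaulay local ring of dimension 2. -/

section CohenMacaulay

variable {R : Type*} [CommRing R] [IsLocalRing R]

theorem IsCohenMacaulayLocalRing.exists_regular_pair (hCM : IsCohenMacaulayLocalRing R)
    (hdim : ringKrullDim R = 2) :
    ∃ c d : R, c ∈ IsLocalRing.maximalIdeal R ∧ d ∈ IsLocalRing.maximalIdeal R ∧
      c ∈ nonZeroDivisors R ∧ ∀ v, c ∣ d * v → c ∣ v := by
  obtain ⟨rs, hrs, hlen⟩ := hCM.exists_isRegular
  have h2 : rs.length = 2 := by
    rw [hdim] at hlen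
    exact_mod_cast hlen.symm
  obtain ⟨c, d, rfl⟩ := List.length_eq_two.1 h2
  have hle : Ideal.ofList [c, d] ≤ IsLocalRing.maximalIdeal R := by
    refine IsLocalRing.le_maximalIdeal fun h => hrs.top_ne_smul ?_
    rw [h, Submodule.top_smul]
  obtain ⟨h1, h2⟩ := (RingTheory.Sequence.isWeaklyRegular_cons_iff R c [d]).1 hrs.toIsWeaklyRegular
  rw [RingTheory.Sequence.isWeaklyRegular_singleton_iff] at h2
  refine ⟨c, d, hle (Ideal.subset_span (by simp)), hle (Ideal.subset_span (by simp)), ?_, ?_⟩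
  · rw [mem_nonZeroDivisors_iff_right]
    intro u hu
    exact h1.right_eq_zero_of_smul (by rw [smul_eq_mul, mul_comm, hu])
  · intro v hv
    have := h2.right_eq_zero_of_smul (x := Submodule.Quotient.mk v) (by
      rw [← Submodule.Quotient.mk_smul, Submodule.Quotient.mk_eq_zero]
      obtain ⟨w, hw⟩ := hv
      rw [smul_eq_mul, hw]
      exact Submodule.smul_mem_pointwise_smul w c ⊤ trivial)
    rw [Submodule.Quotient.mk_eq_zero] at this
    obtain ⟨w, -, rfl⟩ := this
    exact ⟨w, rfl⟩

/-- A power of the maximal ideal lies in I^(n+1) J^(n+1), and the joint reduction equation places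
that product inside (a) + (b). -/
theorem IsJointReduction.exists_maximalIdeal_pow_le [IsNoetherianRing R] {I J : Ideal R} {a b : R}
    (hI : I.radical = IsLocalRing.maximalIdeal R) (hJ : J.radical = IsLocalRing.maximalIdeal R)
    (hab : IsJointReduction I J a b) :
    ∃ n, IsLocalRing.maximalIdeal R ^ n ≤ Ideal.span {a, b} := by
  obtain ⟨n, hn⟩ := hab.eventually_eq
  obtain ⟨i, hi⟩ := Ideal.exists_radical_pow_le_of_fg I (IsNoetherian.noetherian _)
  obtain ⟨j, hj⟩ := Ideal.exists_radical_pow_le_of_fg J (IsNoetherian.noetherian _)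
  rw [hI] at hi
  rw [hJ] at hj
  refine ⟨i * (n + 1) + j * (n + 1), ?_⟩
  rw [pow_add, pow_mul, pow_mul]
  refine (Ideal.mul_mono (Ideal.pow_right_mono hi _) (Ideal.pow_right_mono hj _)).trans ?_
  rw [hn n n le_rfl le_rfl, Ideal.span_insert]
  exact sup_le_sup Ideal.mul_le_left Ideal.mul_le_left

/-- For a regular sequence c, d, the powers c^n, d^n still form one and lie in (a, b) for suitable
n, so depth sensitivity applies. -/
theorem IsJointReduction.koszulAcyclic (hCM : IsCohenMacaulayLocalRing R)
    (hdim : ringKrullDim R = 2) {I J : Ideal R} {a b : R}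
    (hI : I.radical = IsLocalRing.maximalIdeal R) (hJ : J.radical = IsLocalRing.maximalIdeal R)
    (hab : IsJointReduction I J a b) : KoszulAcyclic a b := by
  have := hCM.isNoetherianRing
  obtain ⟨n, hn⟩ := hab.exists_maximalIdeal_pow_le hI hJ
  obtain ⟨c, d, hc, hd, hc', hcd⟩ := hCM.exists_regular_pair hdim
  exact koszulAcyclic_of_mem_span (pow_mem hc' n)
    (fun v hv => dvd_of_pow_mul (fun v hv => pow_dvd_of_mul hc' hcd n hv) n hv)
    (hn (Ideal.pow_mem_pow hc n)) (hn (Ideal.pow_mem_pow hd n))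

end CohenMacaulay

/-! ### Injectivity of the maps μ_k. -/

theorem LModule.exists_mu_injective {R : Type*} [CommRing R] {I J : Ideal R} {a b : R}
    (ha : a ∈ I) (hb : b ∈ J) (hab : KoszulAcyclic a b) (ha' : a ∈ nonZeroDivisors R)
    (hb' : b ∈ nonZeroDivisors R) (hsup : SuperficialConditions I J a b) (r s : ℕ) :
    ∃ k₀ : ℕ, ∀ k : ℕ, k₀ ≤ k → Function.Injective (LModule.mu ha hb r s k) := by
  obtain ⟨m, hm⟩ := hsup.left
  obtain ⟨n, hn⟩ := hsup.right
  refine ⟨m + n, fun k hk => ?_⟩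
  rw [injective_iff_map_eq_zero]
  intro η hη
  obtain ⟨x, rfl⟩ := Submodule.Quotient.mk_surjective _ η
  rw [mu_mk ha hb r s k x (by simpa using pow_mul_mem_num ha hb r s k 1 x.2),
    Submodule.Quotient.mk_eq_zero] at hη
  rw [Submodule.Quotient.mk_eq_zero]
  change a * b * (x : R) ∈ den I J a b r s (k + 1) at hη
  change (x : R) ∈ den I J a b r s k
  obtain ⟨y, hy, y', hy', e⟩ := Submodule.mem_sup.1 hη
  obtain ⟨z, hz, rfl⟩ := Ideal.mem_span_singleton_mul.1 hy
  obtain ⟨z', hz', rfl⟩ := Ideal.mem_span_singleton_mul.1 hy'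
  -- Modulo b the relation reads a^(k+1) z = 0, and a is a nonzerodivisor modulo b; symmetrically
  -- for z'. The superficial conditions then apply with exponents s + k and r + k, which is why k ≥
  -- m + n suffices for every r, s.
  have h1 : b ∣ z := dvd_of_pow_mul (fun v hv => hab.symm.dvd_of_mul hv) (k + 1)
    ⟨a * x - b ^ k * z', by linear_combination e⟩
  have h2 : a ∣ z' := dvd_of_pow_mul (fun v hv => hab.dvd_of_mul hv) (k + 1)
    ⟨b * x - a ^ k * z, by linear_combination e⟩
  have h3 : z ∈ Ideal.span {b} * (I ^ r * J ^ (s + k)) := by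
    rw [← hn r (s + k) (by omega)]
    exact ⟨Ideal.mem_span_singleton.2 h1, hz⟩
  have h4 : z' ∈ Ideal.span {a} * (I ^ (r + k) * J ^ s) := by
    rw [← hm (r + k) s (by omega)]
    exact ⟨Ideal.mem_span_singleton.2 h2, hz'⟩
  obtain ⟨w, hw, rfl⟩ := Ideal.mem_span_singleton_mul.1 h3
  obtain ⟨w', hw', rfl⟩ := Ideal.mem_span_singleton_mul.1 h4
  have h5 : (x : R) = a ^ k * w + b ^ k * w' := by
    refine (mul_cancel_left_mem_nonZeroDivisors (mul_mem ha' hb')).1 ?_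
    linear_combination -e
  rw [h5]
  exact Submodule.add_mem_sup (Ideal.mul_mem_mul (Ideal.mem_span_singleton_self _) hw)
    (Ideal.mul_mem_mul (Ideal.mem_span_singleton_self _) hw')

/-! ### The modules L(r, s; k) inside the Čech cohomology of the extended Rees algebra. -/

namespace extendedRees

variable {R : Type u} [CommRing R] {I J : Ideal R} {a b : R}

/-- The bidegree `(r + k, s + k)`. -/
def shiftedDegree (r s k : ℕ) : ℤ × ℤ := ((r : ℤ) + k, (s : ℤ) + k)

theorem shiftedDegree_eq (r s k : ℕ) :
    k • ((1, 0) : ℤ × ℤ) + k • ((0, 1) : ℤ × ℤ) + ((r : ℤ), (s : ℤ)) = shiftedDegree r s k := by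
  ext <;> simp [shiftedDegree, add_comm]

theorem bigradedPower_shiftedDegree (I J : Ideal R) (r s k : ℕ) :
    bigradedPower I J (shiftedDegree r s k) = LModule.num I J r s k := by
  simp only [bigradedPower, shiftedDegree, LModule.num, ← Nat.cast_add, Int.toNat_natCast]

/-- The inclusion of `I^(r+k) J^(s+k)` as the component of bidegree `(r + k, s + k)`. -/
def numInclusion (I J : Ideal R) (r s k : ℕ) : LModule.num I J r s k →ₗ[R] extendedRees I J where
  toFun c := monomial I J (shiftedDegree r s k) c
    ((bigradedPower_shiftedDegree I J r s k).symm ▸ c.2)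
  map_add' _ _ := Subtype.ext (AddMonoidAlgebra.single_add _ _ _)
  map_smul' _ _ := Subtype.ext (AddMonoidAlgebra.smul_single _ _ _).symm

theorem numInclusion_mem_grading (r s k : ℕ) (c : LModule.num I J r s k) :
    numInclusion I J r s k c ∈ extendedReesGrading I J (shiftedDegree r s k) :=
  monomial_mem_grading _ _ ((bigradedPower_shiftedDegree I J r s k).symm ▸ c.2)

theorem exists_numInclusion_eq {r s k : ℕ} {f : extendedRees I J}
    (hf : f ∈ extendedReesGrading I J (shiftedDegree r s k)) :
    ∃ c, numInclusion I J r s k c = f :=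
  ⟨⟨_, bigradedPower_shiftedDegree I J r s k ▸ f.2 _⟩, (eq_monomial_of_mem_grading hf).symm⟩

theorem mul_pow_mul_numInclusion (ha : a ∈ I) (hb : b ∈ J) (r s k n : ℕ)
    (c : LModule.num I J r s k) (h : (a * b) ^ n * (c : R) ∈ LModule.num I J r s (k + n)) :
    (at₁ J ha * bt₂ I hb) ^ n * numInclusion I J r s k c =
      numInclusion I J r s (k + n) ⟨(a * b) ^ n * (c : R), h⟩ := by
  apply Subtype.ext
  change (AddMonoidAlgebra.single _ a * AddMonoidAlgebra.single _ b) ^ n *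
    AddMonoidAlgebra.single _ (c : R) = AddMonoidAlgebra.single _ _
  rw [AddMonoidAlgebra.single_mul_single, AddMonoidAlgebra.single_pow,
    AddMonoidAlgebra.single_mul_single]
  congr 1
  ext <;> simp [shiftedDegree] <;> ring

/-- Comparing coefficients in bidegree (r + k, s + k), only the coefficients of u in (r, s + k) and
of v in (r + k, s) contribute. As r, s ≥ 0, these range over I^r J^(s+k) and I^(r+k) J^s without
truncation of exponents. -/
theorem numInclusion_mem_span_iff (ha : a ∈ I) (hb : b ∈ J) (r s k : ℕ)
    (c : LModule.num I J r s k) :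
    numInclusion I J r s k c ∈ Ideal.span {at₁ J ha ^ k, bt₂ I hb ^ k} ↔
      (c : R) ∈ LModule.den I J a b r s k := by
  have e1 : shiftedDegree r s k = k • ((1, 0) : ℤ × ℤ) + ((r : ℤ), ((s + k : ℕ) : ℤ)) := by
    ext <;> simp [shiftedDegree, add_comm]
  have e2 : shiftedDegree r s k = k • ((0, 1) : ℤ × ℤ) + (((r + k : ℕ) : ℤ), (s : ℤ)) := by
    ext <;> simp [shiftedDegree, add_comm]
  constructor
  · intro h
    obtain ⟨u, v, huv⟩ := Ideal.mem_span_pair.1 h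
    have h1 := congrArg (fun f : extendedRees I J =>
      (f : AddMonoidAlgebra R (ℤ × ℤ)).coeff (shiftedDegree r s k)) huv
    have hu : ((u * at₁ J ha ^ k : extendedRees I J) : AddMonoidAlgebra R (ℤ × ℤ)).coeff
        (shiftedDegree r s k) = a ^ k *
          (u : AddMonoidAlgebra R (ℤ × ℤ)).coeff ((r : ℤ), ((s + k : ℕ) : ℤ)) := by
      rw [mul_comm, e1]; exact coeff_monomial_pow_mul _ _ _ _ _ _
    have hv : ((v * bt₂ I hb ^ k : extendedRees I J) : AddMonoidAlgebra R (ℤ × ℤ)).coeff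
        (shiftedDegree r s k) = b ^ k *
          (v : AddMonoidAlgebra R (ℤ × ℤ)).coeff (((r + k : ℕ) : ℤ), (s : ℤ)) := by
      rw [mul_comm, e2]; exact coeff_monomial_pow_mul _ _ _ _ _ _
    have hc : ((numInclusion I J r s k c : extendedRees I J) :
        AddMonoidAlgebra R (ℤ × ℤ)).coeff (shiftedDegree r s k) = c :=
      Finsupp.single_eq_same
    simp only [hc] at h1
    rw [← h1, Subalgebra.coe_add, AddMonoidAlgebra.coeff_add, Finsupp.add_apply, hu, hv]
    exact Submodule.add_mem_sup
      (Ideal.mul_mem_mul (Ideal.mem_span_singleton_self _) (u.2 ((r : ℤ), ((s + k : ℕ) : ℤ))))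
      (Ideal.mul_mem_mul (Ideal.mem_span_singleton_self _) (v.2 (((r + k : ℕ) : ℤ), (s : ℤ))))
  · intro h
    obtain ⟨y, hy, y', hy', e⟩ := Submodule.mem_sup.1 h
    obtain ⟨z, hz, rfl⟩ := Ideal.mem_span_singleton_mul.1 hy
    obtain ⟨z', hz', rfl⟩ := Ideal.mem_span_singleton_mul.1 hy'
    refine Ideal.mem_span_pair.2 ⟨monomial I J ((r : ℤ), ((s + k : ℕ) : ℤ)) z hz,
      monomial I J (((r + k : ℕ) : ℤ), (s : ℤ)) z' hz', ?_⟩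
    apply Subtype.ext
    change AddMonoidAlgebra.single _ z * AddMonoidAlgebra.single _ a ^ k +
      AddMonoidAlgebra.single _ z' * AddMonoidAlgebra.single _ b ^ k =
        AddMonoidAlgebra.single _ (c : R)
    rw [AddMonoidAlgebra.single_pow, AddMonoidAlgebra.single_pow,
      AddMonoidAlgebra.single_mul_single, AddMonoidAlgebra.single_mul_single, add_comm _ (k • _),
      add_comm _ (k • _), ← e1, ← e2, ← AddMonoidAlgebra.single_add, ← e, mul_comm z, mul_comm z']

/-- The second Čech cohomology of the extended Rees algebra as an `R`-module. -/
abbrev cechModule (ha : a ∈ I) (hb : b ∈ J) : ModuleCat.{u} R :=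
  (ModuleCat.restrictScalars (algebraMap R (extendedRees I J))).obj
    (ModuleCat.of (extendedRees I J) (CechTop (at₁ J ha) (bt₂ I hb)))

/-- The map `I^(r+k) J^(s+k) → lim_k R' ⧸ ((at₁)^k, (bt₂)^k)`. -/
def numToCech (ha : a ∈ I) (hb : b ∈ J) (r s k : ℕ) :
    LModule.num I J r s k →ₗ[R] cechModule ha hb where
  toFun c := CechTop.mk (at₁ J ha) (bt₂ I hb) k (numInclusion I J r s k c)
  map_add' c d := by rw [map_add, map_add]; rfl
  map_smul' t c := by
    rw [map_smul, Algebra.smul_def, ← smul_eq_mul, map_smul]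
    rfl

/-- The map `L(r, s; k) → lim_k R' ⧸ ((at₁)^k, (bt₂)^k)`. -/
def lmoduleToCech (ha : a ∈ I) (hb : b ∈ J) (r s k : ℕ) :
    LModule I J a b r s k →ₗ[R] cechModule ha hb :=
  Submodule.liftQ _ (numToCech ha hb r s k) fun c hc =>
    CechTop.mk_eq_zero_of_mem _ _ ((numInclusion_mem_span_iff ha hb r s k c).2 hc)

theorem lmoduleToCech_transition (ha : a ∈ I) (hb : b ∈ J) (r s i j : ℕ) (h : i ≤ j)
    (η : LModule I J a b r s i) :
    lmoduleToCech ha hb r s j (LModule.transition ha hb r s i j h η) =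
      lmoduleToCech ha hb r s i η := by
  obtain ⟨n, rfl⟩ := Nat.exists_eq_add_of_le h
  obtain ⟨c, rfl⟩ := Submodule.Quotient.mk_surjective _ η
  have hc := LModule.pow_mul_mem_num ha hb r s i n c.2
  have e : LModule.transition ha hb r s i (i + n) h (Submodule.Quotient.mk c) =
      Submodule.Quotient.mk ⟨(a * b) ^ n * (c : R), hc⟩ := by
    rw [LModule.transition_mk ha hb r s i (i + n) h c (by rwa [Nat.add_sub_cancel_left])]
    simp only [Nat.add_sub_cancel_left]
  rw [e]
  change CechTop.mk _ _ (i + n) (numInclusion I J r s (i + n) _) =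
    CechTop.mk _ _ i (numInclusion I J r s i c)
  rw [← mul_pow_mul_numInclusion ha hb, CechTop.mk_add]

/-- The map `lim_k L(r, s; k) → lim_k R' ⧸ ((at₁)^k, (bt₂)^k)`. -/
def limitToCech (ha : a ∈ I) (hb : b ∈ J) (r s : ℕ) :
    LModule.Limit ha hb r s →ₗ[R] cechModule ha hb :=
  Module.DirectLimit.lift R ℕ _ _ (lmoduleToCech ha hb r s) (lmoduleToCech_transition ha hb r s)

theorem limitToCech_of (ha : a ∈ I) (hb : b ∈ J) (r s k : ℕ) (c : LModule.num I J r s k) :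
    limitToCech ha hb r s (Module.DirectLimit.of R ℕ (fun k => LModule I J a b r s k)
      (fun i j hij => LModule.transition ha hb r s i j hij) k (Submodule.Quotient.mk c)) =
      CechTop.mk (at₁ J ha) (bt₂ I hb) k (numInclusion I J r s k c) := by
  rw [limitToCech, Module.DirectLimit.lift_of]
  rfl

theorem limit_exists_of (ha : a ∈ I) (hb : b ∈ J) (r s : ℕ) (η : LModule.Limit ha hb r s) :
    ∃ k c, Module.DirectLimit.of R ℕ (fun k => LModule I J a b r s k)
      (fun i j hij => LModule.transition ha hb r s i j hij) k (Submodule.Quotient.mk c) = η := by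
  obtain ⟨k, x, rfl⟩ := Module.DirectLimit.exists_of η
  obtain ⟨c, rfl⟩ := Submodule.Quotient.mk_surjective _ x
  exact ⟨k, c, rfl⟩

theorem limitToCech_injective (ha : a ∈ I) (hb : b ∈ J) (r s : ℕ) :
    Function.Injective (limitToCech ha hb r s) := by
  rw [injective_iff_map_eq_zero]
  intro η hη
  obtain ⟨k, c, rfl⟩ := limit_exists_of ha hb r s η
  rw [limitToCech_of] at hη
  obtain ⟨n, hn⟩ := CechTop.mk_eq_zero _ _ hη
  have hc := LModule.pow_mul_mem_num ha hb r s k n c.2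
  rw [mul_pow_mul_numInclusion ha hb r s k n c hc, numInclusion_mem_span_iff] at hn
  rw [← Module.DirectLimit.of_f (hij := Nat.le_add_right k n),
    LModule.transition_mk ha hb r s k (k + n) _ c (by rwa [Nat.add_sub_cancel_left])]
  simp only [Nat.add_sub_cancel_left]
  have h0 : (Submodule.Quotient.mk ⟨(a * b) ^ n * (c : R), hc⟩ : LModule I J a b r s (k + n)) = 0 :=
    (Submodule.Quotient.mk_eq_zero _).2 hn
  rw [h0, map_zero]

/-- The local cohomology component and the direct limit both embed in the Čech cohomology, with the
same image: the fractions whose numerator has bidegree (r + k, s + k). These already form a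
submodule, so taking the span adds nothing. -/
theorem nonempty_localCohomologyComponent_equiv [IsNoetherianRing R] (ha : a ∈ I) (hb : b ∈ J)
    (ha' : a ∈ nonZeroDivisors R) (r s : ℕ) :
    Nonempty (localCohomologyComponent ha hb 2 ((r : ℤ), (s : ℤ)) ≃ₗ[R]
      LModule.Limit ha hb r s) := by
  have := isNoetherianRing (I := I) (J := J)
  obtain ⟨Φ, hΦ, H⟩ := exists_gradedLocalCohomologyToCech
    (extendedReesGrading_isGradedModule I J) one_mem_grading (at₁_mem_grading ha)
    (bt₂_mem_grading hb) (monomial_mem_nonZeroDivisors _ _ ha') (exists_koszulProzero _ _)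
  let Φ' := ((ModuleCat.restrictScalars (algebraMap R (extendedRees I J))).map Φ).hom
  have hrange : (localCohomologyComponent ha hb 2 ((r : ℤ), (s : ℤ))).map Φ' =
      LinearMap.range (limitToCech ha hb r s) := by
    apply le_antisymm
    · rw [Submodule.map_le_iff_le_comap]
      refine Submodule.span_le.2 ?_
      rintro _ ⟨t, ξ, hξ, rfl⟩
      obtain ⟨k, f, hf, e⟩ := (H ((r : ℤ), (s : ℤ)) _).1 ⟨t, ξ, hξ, rfl⟩
      rw [shiftedDegree_eq] at hf
      obtain ⟨c, rfl⟩ := exists_numInclusion_eq hf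
      exact ⟨_, (limitToCech_of ha hb r s k c).trans e⟩
    · rintro _ ⟨η, rfl⟩
      obtain ⟨k, c, rfl⟩ := limit_exists_of ha hb r s η
      rw [limitToCech_of]
      obtain ⟨t, ξ, hξ, e⟩ := (H ((r : ℤ), (s : ℤ)) _).2 ⟨k, _,
        (shiftedDegree_eq r s k).symm ▸ numInclusion_mem_grading r s k c, rfl⟩
      exact ⟨_, Submodule.subset_span ⟨t, ξ, hξ, rfl⟩, e⟩
  exact ⟨(Submodule.equivMapOfInjective Φ' hΦ _).trans ((LinearEquiv.ofEq _ _ hrange).trans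
    (LinearEquiv.ofInjective _ (limitToCech_injective ha hb r s)).symm)⟩

end extendedRees

end

theorem mainTheorem10 {R : Type u} [CommRing R] [IsLocalRing R]
    (hCM : IsCohenMacaulayLocalRing R) (hdim : ringKrullDim R = 2)
    (I J : Ideal R)
    (hI : I.radical = IsLocalRing.maximalIdeal R) (hJ : J.radical = IsLocalRing.maximalIdeal R)
    (a b : R) (hab : IsJointReduction I J a b) (r s : ℕ) :
    Nonempty
      (extendedRees.localCohomologyComponent hab.left_mem hab.right_mem 2 ((r : ℤ), (s : ℤ)) ≃ₗ[R]
        LModule.Limit hab.left_mem hab.right_mem r s) ∧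
    (SuperficialConditions I J a b →
      ∃ k₀ : ℕ, ∀ k : ℕ, k₀ ≤ k →
        Function.Injective (LModule.mu hab.left_mem hab.right_mem r s k)) := by
  have := hCM.isNoetherianRing
  have hacyc := hab.koszulAcyclic hCM hdim hI hJ
  have ha : a ∈ nonZeroDivisors R :=
    hacyc.mem_nonZeroDivisors (hJ ▸ Ideal.le_radical hab.right_mem)
  have hb : b ∈ nonZeroDivisors R :=
    hacyc.symm.mem_nonZeroDivisors (hI ▸ Ideal.le_radical hab.left_mem)
  exact ⟨extendedRees.nonempty_localCohomologyComponent_equiv hab.left_mem hab.right_mem ha r s,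
    fun hs => LModule.exists_mu_injective hab.left_mem hab.right_mem hacyc ha hb hs r s⟩
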